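/- For a positive integer $m$ and rational numbers $a,b$, write $a\equiv b \pmod m$ if $a-b=mc$ for some rational number $c$ whose denominator is prime to $m$. Let $B_k$ denote the $k$-th Bernoulli number, defined by $\frac{x}{e^x-1}=\sum_{k\ge 0}\frac{B_k}{k!}x^k$. Let $p\ge 11$ be a prime, let $n$ be a positive integer, and suppose that $p^r\mid n$ but $p^{r+1}\nmid n$ for some positive integer $r$. Put $$S=\sum_{\substack{l_1+l_2+\cdots+l_6=n\\ l_1,\dots,l_6\ge 1,\ p\nmid l_1,\dots,p\nmid l_6}}\frac{1}{l_1l_2l_3l_4l_5l_6}.$$ (i) If $r=1$, then $$S\equiv \frac{5!}{18}\left(\Big(\frac np\Big)^3-\frac np\right)B_{p-3}^2 \pmod p.$$ (ii) If $r\ge 2$, then $$S\equiv -\frac{5!}{18}\cdot\frac np\,B_{p-3}^2 \pmod{p^r}.$$ -/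

import Mathlib

/-- Congruence of rational numbers modulo a positive integer `m`: the difference is `m` times a
rational number whose denominator is prime to `m`. -/
def RatModEq (m : ℕ) (a b : ℚ) : Prop :=
  ∃ c : ℚ, Nat.Coprime c.den m ∧ a - b = (m : ℚ) * c

/-- The six-variable sum: the sum of `1 / (l₁ l₂ l₃ l₄ l₅ l₆)` over all tuples `(l₁, …, l₆)` of
positive integers prime to `p` with `l₁ + l₂ + l₃ + l₄ + l₅ + l₆ = n`. -/
def sixSum (p n : ℕ) : ℚ :=
  ∑ l ∈ (Finset.Nat.antidiagonalTuple 6 n).filter (fun l => ∀ i, 0 < l i ∧ Nat.Coprime (l i) p),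
    1 / ∏ i, (l i : ℚ)

/-!
Let `f = ∑ X ^ l / l`, over the `l ≥ 1` prime to `p`, so that the six-variable sum is the
coefficient of `X ^ n` in `f ^ 6`. For `n = p N` the proof gives one congruence, uniform in `N ≥ 1`,
`sixSum p (p N) ≡ (20 / 3) (N ^ 3 - N) B_{p-3} ^ 2` modulo `p N`, which contains both cases: if
`p ∣ N`, then `N ^ 3` vanishes to the required order.

The function `N ↦ sixSum p (p N)` is studied through its Mahler expansion `∑ b_k C(N, k)`, where
`b_k` is the `k`-th difference with step `p` at zero and `b_0 = 0`. The `k`-th differences of the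
coefficients of `f` are divisible by `p ^ k`, and each multiplication of power series loses one
power of `p` (`DiffDivisible.convolve`), so `p ^ (k - 5)` divides `b_k`. The right-hand side is
`40 B_{p-3} ^ 2 (C(N, 2) + C(N, 3))`. Since `C(N, k) = (N / k) C(N - 1, k - 1)`, it is enough that
the differences between the Mahler coefficients of the two sides remain divisible by `p` after
division by `k`. For `k ≥ 6` this follows from the bound on `b_k`, and for `k ≤ 5` from the values
modulo `p` at `N = 1, …, 5`.

Modulo `p`, the numerator of `f ^ 6` over `(1 - X ^ p) ^ 6` is the sixth power of the truncated
logarithm. Its coefficients at `p, …, 5p` are palindromic, by `a ↦ p - a`, and add up to zero, by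
homogeneity in `(ZMod p) ^ 6`. So the values at `p` and `2p` determine the others
(`coeff_primeToLogMod_pow_six`).

These two values are computed exactly from `f = L - M`, where `L = -log (1 - X)` and `M` collects
the exponents divisible by `p`. The coefficients of `L ^ k` are elementary symmetric functions of
the `1 / i`. Write `e_i` for those of the `1 / a` with `0 < a < p`. They are divisible by `p` in
positive degree below `p - 1`, and in small odd degree by `p ^ 2` because of the symmetry
`a ↦ p - a`. The value at `p` is `6! e₅ / p ≡ 0`, and the value at `2p` is `360 (e₂ / p) ^ 2` modulo
`p`. Finally `6 e₂ / p` is the coefficient of `X ^ p` in `L ^ 3`, which modulo `p` is a double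
harmonic sum equal to `-2 B_{p-3}` by Faulhaber's formula
(`three_mul_coeff_two_harmonicPoly_add_mem`).
-/

/-! ### Rational numbers that are integral at `p` -/

/-- The subring `ℤ_(p)` of `ℚ`: the rationals whose denominator is prime to `p`. -/
def localInt (p : ℕ) [Fact p.Prime] : Subring ℚ where
  carrier := {x | x.den.Coprime p}
  mul_mem' {x y} hx hy := Nat.Coprime.of_dvd_left (Rat.mul_den_dvd x y) (Nat.Coprime.mul_left hx hy)
  one_mem' := by simp
  add_mem' {x y} hx hy := Nat.Coprime.of_dvd_left (Rat.add_den_dvd x y) (Nat.Coprime.mul_left hx hy)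
  zero_mem' := by simp
  neg_mem' {x} hx := by simpa using hx

section LocalInt

theorem natCast_ne_zero_of_not_dvd {p a : ℕ} (ha : ¬ p ∣ a) : (a : ℚ) ≠ 0 := by
  rintro h0
  exact ha (by simp [Nat.cast_eq_zero.1 h0])

variable {p : ℕ} [hp : Fact p.Prime]

theorem mem_localInt {x : ℚ} : x ∈ localInt p ↔ x.den.Coprime p := Iff.rfl

theorem den_ne_zero_of_mem {x : ℚ} (hx : x ∈ localInt p) : (x.den : ZMod p) ≠ 0 := by
  rw [Ne, ZMod.natCast_eq_zero_iff, ← hp.out.coprime_iff_not_dvd]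
  exact (mem_localInt.1 hx).symm

theorem natCast_inv_mem_localInt {a : ℕ} (ha : ¬ p ∣ a) : (a : ℚ)⁻¹ ∈ localInt p := by
  rw [mem_localInt, Rat.inv_natCast_den]
  split_ifs
  · simp
  · exact ((hp.out.coprime_iff_not_dvd).2 ha).symm

/-- Reduction modulo `p` on `ℤ_(p)`, given by the cast of rationals into the field `ZMod p`. -/
def localRed (p : ℕ) [Fact p.Prime] : localInt p →+* ZMod p where
  toFun x := ((x : ℚ) : ZMod p)
  map_one' := by simp
  map_mul' x y := Rat.cast_mul_of_ne_zero (den_ne_zero_of_mem x.2) (den_ne_zero_of_mem y.2)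
  map_zero' := by simp
  map_add' x y := Rat.cast_add_of_ne_zero (den_ne_zero_of_mem x.2) (den_ne_zero_of_mem y.2)

theorem localRed_apply (x : localInt p) : localRed p x = ((x : ℚ) : ZMod p) := rfl

theorem localRed_inv {a : ℕ} (ha : ¬ p ∣ a) :
    localRed p ⟨(a : ℚ)⁻¹, natCast_inv_mem_localInt ha⟩ = (a : ZMod p)⁻¹ := by
  have h : (a : ZMod p) ≠ 0 := by rwa [Ne, ZMod.natCast_eq_zero_iff]
  have h' : (a : ℚ) ≠ 0 := natCast_ne_zero_of_not_dvd ha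
  refine eq_inv_of_mul_eq_one_left ?_
  rw [← map_natCast (localRed p) a, ← map_mul, ← map_one (localRed p)]
  congr 1
  ext
  simp [h']

/-- The fractional ideal `p ^ k ℤ_(p)` of `ℚ`, for an integer exponent `k`. -/
def padicFil (p : ℕ) [Fact p.Prime] (k : ℤ) : AddSubgroup ℚ where
  carrier := {x | ∃ c ∈ localInt p, x = (p : ℚ) ^ k * c}
  zero_mem' := ⟨0, zero_mem _, by simp⟩
  add_mem' := by
    rintro x y ⟨c, hc, rfl⟩ ⟨d, hd, rfl⟩
    exact ⟨c + d, add_mem hc hd, by ring⟩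
  neg_mem' := by
    rintro x ⟨c, hc, rfl⟩
    exact ⟨-c, neg_mem hc, by ring⟩

theorem prime_cast_ne_zero : (p : ℚ) ≠ 0 := by exact_mod_cast hp.out.ne_zero

theorem mem_padicFil {k : ℤ} {x : ℚ} :
    x ∈ padicFil p k ↔ ∃ c ∈ localInt p, x = (p : ℚ) ^ k * c := Iff.rfl

theorem mem_padicFil_zero {x : ℚ} : x ∈ padicFil p 0 ↔ x ∈ localInt p := by
  simp [mem_padicFil]

theorem mul_mem_padicFil {k l m : ℤ} {x y : ℚ} (hx : x ∈ padicFil p k) (hy : y ∈ padicFil p l)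
    (h : m = k + l) : x * y ∈ padicFil p m := by
  obtain ⟨c, hc, rfl⟩ := hx
  obtain ⟨d, hd, rfl⟩ := hy
  refine ⟨c * d, mul_mem hc hd, ?_⟩
  rw [h, zpow_add₀ prime_cast_ne_zero]
  ring

theorem natCast_mem_padicFil_zero (n : ℕ) : (n : ℚ) ∈ padicFil p 0 :=
  mem_padicFil_zero.2 (natCast_mem _ n)

theorem intCast_mem_padicFil_zero (n : ℤ) : (n : ℚ) ∈ padicFil p 0 :=
  mem_padicFil_zero.2 (intCast_mem _ n)

theorem natCast_inv_mem_padicFil_zero {a : ℕ} (ha : ¬ p ∣ a) : (a : ℚ)⁻¹ ∈ padicFil p 0 :=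
  mem_padicFil_zero.2 (natCast_inv_mem_localInt ha)

theorem zpow_mem_padicFil (k : ℤ) : (p : ℚ) ^ k ∈ padicFil p k := ⟨1, one_mem _, by simp⟩

theorem pow_mem_padicFil (k : ℕ) : (p : ℚ) ^ k ∈ padicFil p k := ⟨1, one_mem _, by simp⟩

theorem prime_mem_padicFil : (p : ℚ) ∈ padicFil p 1 := ⟨1, one_mem _, by simp⟩

theorem prime_inv_mem_padicFil : (p : ℚ)⁻¹ ∈ padicFil p (-1) := ⟨1, one_mem _, by simp⟩

theorem padicFil_mono {k l : ℤ} (h : l ≤ k) {x : ℚ} (hx : x ∈ padicFil p k) :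
    x ∈ padicFil p l := by
  obtain ⟨c, hc, rfl⟩ := hx
  refine ⟨(p : ℚ) ^ (k - l).toNat * c, mul_mem (pow_mem (natCast_mem _ p) _) hc, ?_⟩
  rw [← zpow_natCast, Int.toNat_of_nonneg (by lia), ← mul_assoc, ← zpow_add₀ prime_cast_ne_zero]
  ring_nf

theorem natCast_mul_mem_padicFil (n : ℕ) {k : ℤ} {x : ℚ} (hx : x ∈ padicFil p k) :
    (n : ℚ) * x ∈ padicFil p k :=
  mul_mem_padicFil (natCast_mem_padicFil_zero n) hx (by ring)

/-- Multiplication by a natural number prime to `p` can be cancelled in `p ^ k ℤ_(p)`. -/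
theorem mem_padicFil_of_natCast_mul {a : ℕ} (ha : ¬ p ∣ a) {k : ℤ} {x : ℚ}
    (hx : (a : ℚ) * x ∈ padicFil p k) : x ∈ padicFil p k := by
  have h' : (a : ℚ) ≠ 0 := natCast_ne_zero_of_not_dvd ha
  have := mul_mem_padicFil (natCast_inv_mem_padicFil_zero ha) hx (m := k) (by ring)
  rwa [inv_mul_cancel_left₀ h'] at this

/-- The kernel of reduction modulo `p` is `p ℤ_(p)`. -/
theorem mem_padicFil_one_iff (x : localInt p) : (x : ℚ) ∈ padicFil p 1 ↔ localRed p x = 0 := by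
  constructor
  · rintro ⟨c, hc, h⟩
    have : x = (p : localInt p) * ⟨c, hc⟩ := by
      ext
      simpa using h
    rw [this, map_mul, map_natCast, CharP.cast_eq_zero, zero_mul]
  · intro h
    rw [localRed_apply, Rat.cast_def, div_eq_zero_iff, or_iff_left (den_ne_zero_of_mem x.2),
      ZMod.intCast_zmod_eq_zero_iff_dvd] at h
    obtain ⟨m, hm⟩ := h
    refine ⟨((x : ℚ).den : ℚ)⁻¹ * m, mul_mem (natCast_inv_mem_localInt ?_) (intCast_mem _ m), ?_⟩
    · exact (hp.out.coprime_iff_not_dvd).1 (mem_localInt.1 x.2).symm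
    · conv_lhs => rw [← Rat.num_div_den (x : ℚ), hm]
      push_cast
      rw [zpow_one]
      ring

end LocalInt

/-! ### Sequences with `p`-adically small differences -/

section Differences

variable {p : ℕ} [hp : Fact p.Prime]

/-- The sequences `u` all of whose `k`-th differences with step `p` lie in `p ^ (k - c) ℤ_(p)`:
the values of `u` along each residue class modulo `p` have Mahler coefficients that tend
`p`-adically to zero at a linear rate, with a defect `c`. -/
def DiffDivisible (p : ℕ) [Fact p.Prime] (c : ℤ) (u : ℕ → ℚ) : Prop :=
  ∀ k n : ℕ, (fwdDiff p)^[k] u n ∈ padicFil p (k - c)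

theorem DiffDivisible.forwardDiff {c : ℤ} {u : ℕ → ℚ} (hu : DiffDivisible p c u) :
    DiffDivisible p (c - 1) (fwdDiff p u) := fun k n ↦ by
  have := hu (k + 1) n
  rw [Function.iterate_succ_apply] at this
  exact padicFil_mono (by push_cast; lia) this

theorem DiffDivisible.apply_mem {c : ℤ} {u : ℕ → ℚ} (hu : DiffDivisible p c u) (n : ℕ) :
    u n ∈ padicFil p (-c) := by
  simpa using hu 0 n

/-- The convolution of two sequences, that is, the coefficients of the product of their generating
functions. -/
def seqConv (u v : ℕ → ℚ) (n : ℕ) : ℚ := ∑ j ∈ Finset.range (n + 1), u (n - j) * v j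

theorem coeff_mul_eq_seqConv (A B : PowerSeries ℚ) (n : ℕ) :
    PowerSeries.coeff n (A * B)
      = seqConv (fun i ↦ PowerSeries.coeff i A) (fun i ↦ PowerSeries.coeff i B) n := by
  rw [mul_comm, PowerSeries.coeff_mul, seqConv,
    Finset.Nat.sum_antidiagonal_eq_sum_range_succ
      (fun i j ↦ PowerSeries.coeff i B * PowerSeries.coeff j A)]
  exact Finset.sum_congr rfl fun j _ ↦ mul_comm _ _

/-- Discrete Leibniz rule with all differences on the second factor. The boundary terms come from
the `p` new indices that enter when the argument grows by `p`. -/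
theorem fwdDiff_seqConv (p : ℕ) (u v : ℕ → ℚ) :
    fwdDiff p (seqConv u v) = seqConv u (fwdDiff p v)
      + ∑ j ∈ Finset.range p, v j • fun n ↦ u (n + (p - j)) := by
  ext n
  have h1 : seqConv u v (n + p) = (∑ j ∈ Finset.range p, u (n + (p - j)) * v j)
      + ∑ j ∈ Finset.range (n + 1), u (n - j) * v (j + p) := by
    rw [seqConv, show n + p + 1 = p + (n + 1) by ring, Finset.sum_range_add]
    congr 1
    · refine Finset.sum_congr rfl fun j hj ↦ ?_
      rw [Nat.add_sub_assoc (Finset.mem_range.1 hj).le]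
    · refine Finset.sum_congr rfl fun j hj ↦ ?_
      rw [add_comm p j, Nat.add_sub_add_right]
  simp only [Pi.add_apply, Finset.sum_apply, Pi.smul_apply, smul_eq_mul]
  rw [fwdDiff, h1, seqConv, seqConv]
  simp only [fwdDiff, mul_sub, Finset.sum_sub_distrib, mul_comm (v _)]
  ring

/-- A convolution loses only one power of `p`, because differencing it puts all differences on one
factor, up to boundary terms that involve translates of the other factor. -/
theorem DiffDivisible.convolve {c d : ℤ} {u v : ℕ → ℚ} (hu : DiffDivisible p c u)
    (hv : DiffDivisible p d v) : DiffDivisible p (c + d + 1) (seqConv u v) := by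
  intro k
  induction k generalizing d v with
  | zero =>
    intro n
    rw [Function.iterate_zero, id, seqConv]
    refine sum_mem fun j _ ↦ padicFil_mono ?_
      (mul_mem_padicFil (hu.apply_mem (n - j)) (hv.apply_mem j) rfl)
    push_cast
    lia
  | succ k ih =>
    intro n
    rw [Function.iterate_succ_apply, fwdDiff_seqConv, fwdDiff_iter_add, fwdDiff_iter_finsetSum,
      Pi.add_apply, Finset.sum_apply]
    refine add_mem ?_ (sum_mem fun j _ ↦ ?_)
    · exact padicFil_mono (by push_cast; lia) (ih hv.forwardDiff n)
    · rw [fwdDiff_iter_const_smul, Pi.smul_apply, smul_eq_mul, fwdDiff_iter_comp_add]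
      refine mul_mem_padicFil (hv.apply_mem j) (hu k (n + (p - j))) ?_
      push_cast
      ring

theorem DiffDivisible.coeff_mul {c d : ℤ} {A B : PowerSeries ℚ}
    (hA : DiffDivisible p c fun n ↦ PowerSeries.coeff n A)
    (hB : DiffDivisible p d fun n ↦ PowerSeries.coeff n B) :
    DiffDivisible p (c + d + 1) fun n ↦ PowerSeries.coeff n (A * B) := by
  simp only [coeff_mul_eq_seqConv]
  exact hA.convolve hB

/-- The power series `∑ X ^ l / l`, over the `l ≥ 1` prime to `p`. -/
noncomputable def primeToLog (p : ℕ) : PowerSeries ℚ :=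
  PowerSeries.mk fun l ↦ if p ∣ l then 0 else (l : ℚ)⁻¹

/-- Iterated differences of `1 / n` in closed form. Steps of length `p` do not change whether
`p ∣ n`. -/
theorem fwdDiff_iter_coeff_primeToLog (p k n : ℕ) :
    (fwdDiff p)^[k] (fun l ↦ PowerSeries.coeff l (primeToLog p)) n
      = if p ∣ n then 0 else
        (-1) ^ k * k.factorial * p ^ k * ∏ i ∈ Finset.range (k + 1), ((n + i * p : ℕ) : ℚ)⁻¹ := by
  induction k generalizing n with
  | zero => simp [primeToLog]
  | succ k ih =>
    rw [Function.iterate_succ_apply', fwdDiff, ih, ih]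
    simp only [Nat.dvd_add_self_right]
    split_ifs with h
    · simp
    · have hne (i : ℕ) : ((n + i * p : ℕ) : ℚ) ≠ 0 := by
        intro h0
        have h0 : n + i * p = 0 := by exact_mod_cast h0
        exact h (by simp [show n = 0 by lia])
      have e1 : ∏ i ∈ Finset.range (k + 1), ((n + p + i * p : ℕ) : ℚ)⁻¹
          = n * ∏ i ∈ Finset.range (k + 2), ((n + i * p : ℕ) : ℚ)⁻¹ := by
        rw [Finset.prod_range_succ' _ (k + 1), mul_comm, mul_assoc]
        have := hne 0
        simp only [zero_mul, add_zero] at this ⊢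
        rw [inv_mul_cancel₀ this, mul_one]
        refine Finset.prod_congr rfl fun i _ ↦ ?_
        rw [show n + p + i * p = n + (i + 1) * p by ring]
      have e2 : ∏ i ∈ Finset.range (k + 1), ((n + i * p : ℕ) : ℚ)⁻¹
          = (n + (k + 1) * p) * ∏ i ∈ Finset.range (k + 2), ((n + i * p : ℕ) : ℚ)⁻¹ := by
        rw [Finset.prod_range_succ _ (k + 1), mul_comm, mul_assoc]
        have := hne (k + 1)
        push_cast at this ⊢
        rw [inv_mul_cancel₀ this, mul_one]
      rw [e1, e2, Nat.factorial_succ]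
      push_cast
      ring

theorem diffDivisible_primeToLog :
    DiffDivisible p 0 fun l ↦ PowerSeries.coeff l (primeToLog p) := by
  intro k n
  rw [fwdDiff_iter_coeff_primeToLog]
  split_ifs with h
  · exact zero_mem _
  · refine mul_mem_padicFil (l := 0) (mul_mem_padicFil (k := 0) ?_ (pow_mem_padicFil k) rfl)
      (mem_padicFil_zero.2 (prod_mem fun i _ ↦ natCast_inv_mem_localInt ?_)) (by ring)
    · exact mem_padicFil_zero.2
        (mul_mem (pow_mem (neg_mem (one_mem _)) _) (natCast_mem _ k.factorial))
    · rwa [Nat.dvd_add_left (dvd_mul_left p i)]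

theorem diffDivisible_primeToLog_pow (k : ℕ) :
    DiffDivisible p k fun l ↦ PowerSeries.coeff l (primeToLog p ^ (k + 1)) := by
  induction k with
  | zero => simpa using diffDivisible_primeToLog (p := p)
  | succ k ih =>
    have := ih.coeff_mul (diffDivisible_primeToLog (p := p))
    rw [pow_succ]
    exact fun m n ↦ padicFil_mono (by push_cast; lia) (this m n)

end Differences

/-- The condition that every `l i` be positive is absorbed by coprimality, since `p ∣ 0`. -/
theorem sixSum_eq_coeff {p : ℕ} [hp : Fact p.Prime] (n : ℕ) :
    sixSum p n = PowerSeries.coeff n (primeToLog p ^ 6) := by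
  have h := PowerSeries.coeff_prod (fun _ : Fin 6 ↦ primeToLog p) n Finset.univ
  simp only [Finset.prod_const, Finset.card_univ, Fintype.card_fin] at h
  rw [h, sixSum, Finset.sum_filter]
  refine (Finset.sum_equiv Finsupp.equivFunOnFinite (fun l ↦ ?_) fun l _ ↦ ?_).symm
  · simp [Finset.Nat.mem_antidiagonalTuple]
  · have hl (a : ℕ) : (0 < a ∧ a.Coprime p) ↔ ¬ p ∣ a := by
      rw [Nat.coprime_comm, hp.out.coprime_iff_not_dvd, and_iff_right_iff_imp]
      rintro h
      exact Nat.pos_of_ne_zero fun h0 ↦ h (by simp [h0])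
    simp only [hl, Finsupp.equivFunOnFinite_apply, primeToLog, PowerSeries.coeff_mk]
    split_ifs with h
    · rw [one_div, ← Finset.prod_inv_distrib]
      exact Finset.prod_congr rfl fun i _ ↦ if_neg (h i)
    · push Not at h
      obtain ⟨i, hi⟩ := h
      exact Finset.prod_eq_zero (Finset.mem_univ i) (if_pos hi)

/-! ### The sixth power of the truncated logarithm modulo `p` -/

section ModPrime

/-- The series `∑ X ^ l / l`, over the `l ≥ 1` prime to `p`, with coefficients in `ℤ_(p)`. -/
noncomputable def primeToLogLocal (p : ℕ) [Fact p.Prime] : PowerSeries (localInt p) :=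
  PowerSeries.mk fun l ↦ if h : p ∣ l then 0 else ⟨(l : ℚ)⁻¹, natCast_inv_mem_localInt h⟩

/-- The series `∑ X ^ l / l` modulo `p`. The terms with `p ∣ l` vanish because `0⁻¹ = 0`. -/
noncomputable def primeToLogMod (p : ℕ) [Fact p.Prime] : PowerSeries (ZMod p) :=
  PowerSeries.mk fun l ↦ (l : ZMod p)⁻¹

/-- The truncation `∑ X ^ a / a`, over `a < p`, of the series `∑ X ^ l / l` modulo `p`. -/
noncomputable def truncLogMod (p : ℕ) [Fact p.Prime] : Polynomial (ZMod p) :=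
  ∑ a : ZMod p, Polynomial.C a⁻¹ * Polynomial.X ^ a.val

variable {p : ℕ} [hp : Fact p.Prime]

theorem map_subtype_primeToLogLocal :
    (primeToLogLocal p).map (localInt p).subtype = primeToLog p := by
  ext l
  simp only [primeToLogLocal, primeToLog, PowerSeries.coeff_map, PowerSeries.coeff_mk]
  split_ifs <;> simp

theorem map_localRed_primeToLogLocal :
    (primeToLogLocal p).map (localRed p) = primeToLogMod p := by
  ext l
  simp only [primeToLogLocal, primeToLogMod, PowerSeries.coeff_map, PowerSeries.coeff_mk]
  split_ifs with h
  · rw [(ZMod.natCast_eq_zero_iff l p).2 h, map_zero, inv_zero]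
  · exact localRed_inv h

theorem coe_coeff_primeToLogLocal_pow (n k : ℕ) :
    ((PowerSeries.coeff n (primeToLogLocal p ^ k) : localInt p) : ℚ)
      = PowerSeries.coeff n (primeToLog p ^ k) := by
  rw [← map_subtype_primeToLogLocal, ← map_pow, PowerSeries.coeff_map]
  rfl

theorem localRed_coeff_primeToLogLocal_pow (n k : ℕ) :
    localRed p (PowerSeries.coeff n (primeToLogLocal p ^ k))
      = PowerSeries.coeff n (primeToLogMod p ^ k) := by
  rw [← map_localRed_primeToLogLocal, ← map_pow, PowerSeries.coeff_map]

theorem exists_pow_ne_one {k : ℕ} (hk : 0 < k) (hkp : k < p - 1) :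
    ∃ x : ZMod p, x ≠ 0 ∧ x ^ k ≠ 1 := by
  have h : ¬ ∀ x : (ZMod p)ˣ, x ^ k = 1 := by
    rw [FiniteField.forall_pow_eq_one_iff, ZMod.card]
    exact Nat.not_dvd_of_pos_of_lt hk hkp
  push Not at h
  obtain ⟨x, hx⟩ := h
  exact ⟨x, x.ne_zero, fun h ↦ hx (Units.ext (by simpa using h))⟩

theorem coeff_truncLogMod (n : ℕ) :
    (truncLogMod p).coeff n = if n ≤ p then (n : ZMod p)⁻¹ else 0 := by
  have h1 : (truncLogMod p).coeff n = ∑ a : ZMod p, if n = a.val then a⁻¹ else 0 := by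
    simp only [truncLogMod, Polynomial.finsetSum_coeff, Polynomial.coeff_C_mul_X_pow]
  rw [h1]
  rcases lt_trichotomy n p with h | rfl | h
  · rw [if_pos h.le, Finset.sum_eq_single (n : ZMod p), if_pos (ZMod.val_cast_of_lt h).symm]
    · intro a _ ha
      refine if_neg fun hn ↦ ha ?_
      rw [hn, ZMod.natCast_zmod_val]
    · simp
  · rw [if_pos le_rfl, CharP.cast_eq_zero, inv_zero]
    exact Finset.sum_eq_zero fun a _ ↦ if_neg (ZMod.val_lt a).ne'
  · rw [if_neg h.not_ge]
    exact Finset.sum_eq_zero fun a _ ↦ if_neg ((ZMod.val_lt a).trans h).ne'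

/-- Modulo `p` the coefficients are periodic, so the series is its first period over `1 - X ^ p`. -/
theorem primeToLogMod_mul_one_sub :
    primeToLogMod p * (1 - PowerSeries.X ^ p) = (truncLogMod p : PowerSeries (ZMod p)) := by
  ext n
  rw [mul_sub, mul_one, map_sub, PowerSeries.coeff_mul_X_pow', Polynomial.coeff_coe,
    coeff_truncLogMod]
  simp only [primeToLogMod, PowerSeries.coeff_mk]
  rcases lt_trichotomy n p with h | rfl | h
  · simp [h.not_ge, h.le]
  · simp
  · rw [if_pos h.le, if_neg h.not_ge, Nat.cast_sub h.le, CharP.cast_eq_zero (ZMod p) p,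
      sub_zero, sub_self]

theorem natDegree_truncLogMod_le : (truncLogMod p).natDegree ≤ p := by
  rw [Polynomial.natDegree_le_iff_coeff_eq_zero]
  intro n hn
  rw [coeff_truncLogMod, if_neg (by lia)]

/-- The substitution `a ↦ p - a` changes the sign of `1 / a` modulo `p`. -/
theorem reflect_truncLogMod : (truncLogMod p).reflect p = -truncLogMod p := by
  ext n
  rw [Polynomial.coeff_reflect, Polynomial.coeff_neg, coeff_truncLogMod, coeff_truncLogMod]
  by_cases h : n ≤ p
  · rw [Polynomial.revAt_le h, if_pos (Nat.sub_le _ _), if_pos h, Nat.cast_sub h,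
      CharP.cast_eq_zero, zero_sub, inv_neg]
  · rw [Polynomial.revAt_eq_self_of_lt (by lia), if_neg h, neg_zero]

theorem reflect_truncLogMod_pow (k : ℕ) :
    (truncLogMod p ^ k).reflect (k * p) = (-truncLogMod p) ^ k := by
  induction k with
  | zero => simp
  | succ k ih =>
    have h : (truncLogMod p ^ k).natDegree ≤ k * p :=
      Polynomial.natDegree_pow_le_of_le k natDegree_truncLogMod_le
    rw [pow_succ, add_mul, one_mul, Polynomial.reflect_mul _ _ h natDegree_truncLogMod_le, ih,
      reflect_truncLogMod, pow_succ]

theorem coeff_truncLogMod_pow_six_symm {s : ℕ} (hs : s ≤ 6) :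
    (truncLogMod p ^ 6).coeff ((6 - s) * p) = (truncLogMod p ^ 6).coeff (s * p) := by
  have h := congrArg (fun P ↦ P.coeff (s * p)) (reflect_truncLogMod_pow (p := p) 6)
  simp only [Polynomial.coeff_reflect] at h
  rwa [Polynomial.revAt_le (Nat.mul_le_mul_right p hs), ← Nat.sub_mul,
    Even.neg_pow (by decide)] at h

theorem coeff_truncLogMod_pow (k n : ℕ) : (truncLogMod p ^ k).coeff n
    = ∑ v : Fin k → ZMod p, if n = ∑ i, (v i).val then ∏ i, (v i)⁻¹ else 0 := by
  simp only [truncLogMod, Fintype.sum_pow, Finset.prod_mul_distrib, Finset.prod_pow_eq_pow_sum,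
    ← map_prod, Polynomial.finsetSum_coeff, Polynomial.coeff_C_mul_X_pow]

/-- The coefficients at multiples of `p` sum over the tuples in `ZMod p` whose sum is zero. -/
theorem sum_coeff_truncLogMod_pow {k : ℕ} (hk : 0 < k) :
    ∑ s ∈ Finset.range k, (truncLogMod p ^ k).coeff (s * p)
      = ∑ v : Fin k → ZMod p, if ∑ i, v i = 0 then ∏ i, (v i)⁻¹ else 0 := by
  simp only [coeff_truncLogMod_pow]
  rw [Finset.sum_comm]
  refine Finset.sum_congr rfl fun v _ ↦ ?_
  have hv : ∑ i, v i = 0 ↔ p ∣ ∑ i, (v i).val := by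
    rw [← ZMod.natCast_eq_zero_iff]
    simp
  simp only [hv]
  split_ifs with h
  · obtain ⟨c, hc⟩ := h
    have hlt : ∑ i, (v i).val < k * p := by
      have : Nonempty (Fin k) := ⟨⟨0, hk⟩⟩
      calc ∑ i, (v i).val < ∑ _i : Fin k, p :=
            Finset.sum_lt_sum_of_nonempty Finset.univ_nonempty fun i _ ↦ ZMod.val_lt _
        _ = k * p := by simp
    rw [Finset.sum_eq_single c, if_pos (by rw [hc, mul_comm])]
    · intro s _ hs
      refine if_neg fun h ↦ hs ?_
      rw [hc, mul_comm] at h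
      exact Nat.eq_of_mul_eq_mul_left hp.out.pos h
    · intro hck
      refine absurd ?_ hck
      rw [hc, mul_comm] at hlt
      exact Finset.mem_range.2 (Nat.lt_of_mul_lt_mul_right hlt)
  · refine Finset.sum_eq_zero fun s _ ↦ if_neg fun hs ↦ h ⟨s, by rw [← hs, mul_comm]⟩

/-- Multiplying all variables by `x` multiplies the sum by `x⁻¹ ^ k`, and some unit `x`
has `x ^ k ≠ 1`. -/
theorem sum_prod_inv_eq_zero {k : ℕ} (hk : 0 < k) (hkp : k < p - 1) :
    (∑ v : Fin k → ZMod p, if ∑ i, v i = 0 then ∏ i, (v i)⁻¹ else 0) = 0 := by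
  obtain ⟨x, hx0, hx⟩ := exists_pow_ne_one hk hkp
  set W := ∑ v : Fin k → ZMod p, if ∑ i, v i = 0 then ∏ i, (v i)⁻¹ else 0 with hW
  have h : W = x⁻¹ ^ k * W := by
    conv_lhs => rw [hW]
    rw [← Equiv.sum_comp (Equiv.piCongrRight fun _ : Fin k ↦ Equiv.mulLeft₀ x hx0), hW,
      Finset.mul_sum]
    refine Finset.sum_congr rfl fun v _ ↦ ?_
    simp only [Equiv.piCongrRight_apply, Pi.map_apply, Equiv.mulLeft₀_apply, ← Finset.mul_sum,
      mul_eq_zero, hx0, false_or, mul_inv, Finset.prod_mul_distrib, Finset.prod_const,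
      Finset.card_univ, Fintype.card_fin]
    rw [mul_ite, mul_zero]
  have h' : (x ^ k - 1) * W = 0 := by
    have hxk : x ^ k * x⁻¹ ^ k = 1 := by rw [← mul_pow, mul_inv_cancel₀ hx0, one_pow]
    linear_combination x ^ k * h + W * hxk
  exact (mul_eq_zero.1 h').resolve_left (sub_ne_zero.2 hx)

theorem coeff_truncLogMod_pow_six (s : ℕ) : (truncLogMod p ^ 6).coeff (s * p)
    = ∑ j ∈ Finset.range 7, (-1) ^ j * (Nat.choose 6 j : ZMod p) *
      if j ≤ s then PowerSeries.coeff ((s - j) * p) (primeToLogMod p ^ 6) else 0 := by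
  have h : ((truncLogMod p ^ 6 : Polynomial (ZMod p)) : PowerSeries (ZMod p))
      = ∑ j ∈ Finset.range 7, PowerSeries.C ((-1) ^ j * (Nat.choose 6 j : ZMod p)) *
        (primeToLogMod p ^ 6 * PowerSeries.X ^ (j * p)) := by
    rw [Polynomial.coe_pow, ← primeToLogMod_mul_one_sub, mul_pow, sub_eq_neg_add, add_pow,
      Finset.mul_sum]
    refine Finset.sum_congr rfl fun j _ ↦ ?_
    rw [neg_pow, ← pow_mul, mul_comm p j, one_pow]
    simp
    ring
  rw [← Polynomial.coeff_coe, h, map_sum]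
  refine Finset.sum_congr rfl fun j _ ↦ ?_
  rw [PowerSeries.coeff_C_mul, PowerSeries.coeff_mul_X_pow', ← Nat.sub_mul]
  congr 1
  simp only [Nat.mul_le_mul_right_iff hp.out.pos]

/-- Modulo `p`, the values at `p, 2p, …, 5p` are determined by those at `p` and `2p`, because the
generating polynomial of the residues is palindromic and sums to zero. -/
theorem coeff_primeToLogMod_pow_six (hp11 : 11 ≤ p)
    (h1 : PowerSeries.coeff p (primeToLogMod p ^ 6) = 0) :
    PowerSeries.coeff (3 * p) (primeToLogMod p ^ 6)
        = 4 * PowerSeries.coeff (2 * p) (primeToLogMod p ^ 6) ∧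
      PowerSeries.coeff (4 * p) (primeToLogMod p ^ 6)
        = 10 * PowerSeries.coeff (2 * p) (primeToLogMod p ^ 6) ∧
      PowerSeries.coeff (5 * p) (primeToLogMod p ^ 6)
        = 20 * PowerSeries.coeff (2 * p) (primeToLogMod p ^ 6) := by
  have h0 : PowerSeries.coeff 0 (primeToLogMod p ^ 6) = 0 := by
    simp [primeToLogMod]
  have hs := (sum_coeff_truncLogMod_pow (p := p) (k := 6) (by norm_num)).trans
    (sum_prod_inv_eq_zero (by norm_num) (by lia))
  have e15 := coeff_truncLogMod_pow_six_symm (p := p) (s := 1) (by norm_num)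
  have e24 := coeff_truncLogMod_pow_six_symm (p := p) (s := 2) (by norm_num)
  simp only [coeff_truncLogMod_pow_six] at hs e15 e24
  simp [Finset.sum_range_succ, Nat.choose, h0, h1] at hs e15 e24
  refine ⟨?_, ?_, ?_⟩
  · linear_combination hs - e15 - e24
  · linear_combination e24 + 6 * (hs - e15 - e24)
  · linear_combination e15 + 6 * (e24 + 6 * (hs - e15 - e24)) - 15 * (hs - e15 - e24)

end ModPrime

/-! ### Powers of the logarithm and elementary symmetric functions -/

section LogSeries

open PowerSeries (X coeff)

/-- The power series `-log (1 - X) = ∑ X ^ n / n`, where the constant term is `0⁻¹ = 0`. -/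
noncomputable def logSeries : PowerSeries ℚ := PowerSeries.mk fun n ↦ (n : ℚ)⁻¹

/-- The polynomial `∏ (1 + X / i)`, over `m < i ≤ m + n`, whose coefficients are the elementary
symmetric functions of the `1 / i`. -/
noncomputable def harmonicPoly (m n : ℕ) : Polynomial ℚ :=
  ∏ i ∈ Finset.range n, (1 + Polynomial.C ((m + i + 1 : ℕ) : ℚ)⁻¹ * Polynomial.X)

theorem one_sub_X_mul_derivative_logSeries :
    (1 - X) * PowerSeries.derivative ℚ logSeries = 1 := by
  ext n
  rw [sub_mul, one_mul, map_sub]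
  cases n with
  | zero => simp [logSeries, PowerSeries.coeff_derivative]
  | succ n =>
    rw [PowerSeries.coeff_succ_X_mul, PowerSeries.coeff_derivative, PowerSeries.coeff_derivative,
      PowerSeries.coeff_one, if_neg n.succ_ne_zero]
    simp only [logSeries, PowerSeries.coeff_mk]
    push_cast
    rw [inv_mul_cancel₀ (by positivity), inv_mul_cancel₀ (by positivity), sub_self]

/-- The differential equation `(1 - X) (L ^ (k + 1))' = (k + 1) L ^ k`, read off coefficientwise. -/
theorem coeff_logSeries_pow_succ (k n : ℕ) :
    (n + 1 : ℚ) * coeff (n + 1) (logSeries ^ (k + 1))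
      = n * coeff n (logSeries ^ (k + 1)) + (k + 1) * coeff n (logSeries ^ k) := by
  have h : (1 - X) * PowerSeries.derivative ℚ (logSeries ^ (k + 1))
      = PowerSeries.C (k + 1 : ℚ) * logSeries ^ k := by
    rw [PowerSeries.derivative_pow]
    push_cast
    simp only [map_add, map_one, map_natCast]
    linear_combination (k + 1 : PowerSeries ℚ) * logSeries ^ k * one_sub_X_mul_derivative_logSeries
  have hn := congrArg (coeff n) h
  rw [sub_mul, one_mul, map_sub, PowerSeries.coeff_C_mul, PowerSeries.coeff_derivative] at hn
  rw [← hn]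
  cases n with
  | zero => simp
  | succ n =>
    rw [PowerSeries.coeff_succ_X_mul, PowerSeries.coeff_derivative]
    push_cast
    ring

theorem coeff_mul_one_add_C_mul_X_succ (P : Polynomial ℚ) (a : ℚ) (k : ℕ) :
    (P * (1 + Polynomial.C a * Polynomial.X)).coeff (k + 1) = P.coeff (k + 1) + a * P.coeff k := by
  rw [mul_add, mul_one, Polynomial.coeff_add, mul_left_comm, Polynomial.coeff_C_mul,
    Polynomial.coeff_mul_X]

theorem harmonicPoly_succ (m n : ℕ) : harmonicPoly m (n + 1)
    = harmonicPoly m n * (1 + Polynomial.C ((m + n + 1 : ℕ) : ℚ)⁻¹ * Polynomial.X) :=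
  Finset.prod_range_succ _ _

theorem harmonicPoly_add (m n k : ℕ) :
    harmonicPoly m (n + k) = harmonicPoly m n * harmonicPoly (m + n) k := by
  rw [harmonicPoly, Finset.prod_range_add, harmonicPoly, harmonicPoly]
  simp only [add_assoc]

theorem coeff_zero_harmonicPoly (m n : ℕ) : (harmonicPoly m n).coeff 0 = 1 := by
  simp [harmonicPoly, Polynomial.coeff_zero_prod]

/-- This is the formula `(-log (1 - x)) ^ k / k! = ∑ c(n, k) x ^ n / n!` with the Stirling numbers
`c(n, k)` of the first kind expressed through elementary symmetric functions. -/
theorem coeff_logSeries_pow (k n : ℕ) :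
    (n + 1 : ℚ) * coeff (n + 1) (logSeries ^ (k + 1))
      = (k + 1).factorial * (harmonicPoly 0 n).coeff k := by
  induction n generalizing k with
  | zero =>
    rw [coeff_logSeries_pow_succ]
    cases k with
    | zero => simp [harmonicPoly]
    | succ k => simp [harmonicPoly, logSeries, Polynomial.coeff_one]
  | succ n ih =>
    rw [coeff_logSeries_pow_succ, Nat.cast_add_one, ih, harmonicPoly_succ]
    cases k with
    | zero => simp [PowerSeries.coeff_one]
    | succ k =>
      have hn : (n + 1 : ℚ) ≠ 0 := by positivity
      have e : coeff (n + 1) (logSeries ^ (k + 1))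
          = (n + 1 : ℚ)⁻¹ * ((k + 1).factorial * (harmonicPoly 0 n).coeff k) := by
        rw [← ih, inv_mul_cancel_left₀ hn]
      rw [e, coeff_mul_one_add_C_mul_X_succ, Nat.factorial_succ (k + 1)]
      push_cast
      ring

theorem coeff_logSeries_pow_prime (k : ℕ) {p : ℕ} (hp : p ≠ 0) :
    coeff p (logSeries ^ (k + 1))
      = (p : ℚ)⁻¹ * (k + 1).factorial * (harmonicPoly 0 (p - 1)).coeff k := by
  obtain ⟨n, rfl⟩ := Nat.exists_eq_succ_of_ne_zero hp
  have h := coeff_logSeries_pow k n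
  have hn : (n + 1 : ℚ) ≠ 0 := by positivity
  rw [mul_assoc, Nat.succ_sub_one, ← h, Nat.succ_eq_add_one, Nat.cast_add_one,
    inv_mul_cancel_left₀ hn]

/-- The part `∑ X ^ n / n`, over the `n` divisible by `p`, of the series `-log (1 - X)`. -/
noncomputable def dvdLog (p : ℕ) : PowerSeries ℚ :=
  PowerSeries.mk fun l ↦ if p ∣ l then (l : ℚ)⁻¹ else 0

theorem primeToLog_eq_sub (p : ℕ) : primeToLog p = logSeries - dvdLog p := by
  ext l
  simp only [primeToLog, logSeries, dvdLog, map_sub, PowerSeries.coeff_mk]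
  split_ifs <;> simp

theorem X_dvd_logSeries : X ∣ logSeries := by
  rw [PowerSeries.X_dvd_iff]
  simp [logSeries]

theorem X_pow_dvd_dvdLog (p : ℕ) : X ^ p ∣ dvdLog p := by
  rw [PowerSeries.X_pow_dvd_iff]
  intro m hm
  rw [dvdLog, PowerSeries.coeff_mk]
  split_ifs with h
  · rw [Nat.eq_zero_of_dvd_of_lt h hm, Nat.cast_zero, inv_zero]
  · rfl

theorem coeff_prime_primeToLog_pow {p : ℕ} (hp : 0 < p) (k : ℕ) :
    coeff p (primeToLog p ^ (k + 2)) = coeff p (logSeries ^ (k + 2)) := by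
  have hM := X_pow_dvd_dvdLog p
  have hXf : X ∣ primeToLog p := by
    rw [primeToLog_eq_sub]
    exact dvd_sub X_dvd_logSeries ((dvd_pow_self X hp.ne').trans hM)
  have h : X ^ p * X ∣ primeToLog p ^ (k + 2) - logSeries ^ (k + 2) := by
    rw [← (Commute.all _ _).mul_geom_sum₂]
    refine mul_dvd_mul ?_ (Finset.dvd_sum fun i _ ↦ ?_)
    · rwa [primeToLog_eq_sub, sub_sub_cancel_left, dvd_neg]
    · rcases Nat.eq_zero_or_pos i with rfl | hi
      · exact (X_dvd_logSeries.trans (dvd_pow_self _ (by lia))).mul_left _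
      · exact (hXf.trans (dvd_pow_self _ hi.ne')).mul_right _
  rw [← pow_succ, PowerSeries.X_pow_dvd_iff] at h
  have := h p (by lia)
  rwa [map_sub, sub_eq_zero] at this

/-- With `L = -log (1 - X)` and `M` its part at multiples of `p`, in `(L - M) ^ 6` only `L ^ 6` and
`-6 L ^ 5 M` contribute in degree `2p`, because `M` is divisible by `X ^ p` and `L` by `X`. -/
theorem coeff_two_mul_prime_primeToLog_pow_six {p : ℕ} (hp : 0 < p) :
    coeff (2 * p) (primeToLog p ^ 6)
      = coeff (2 * p) (logSeries ^ 6) - 6 * (p : ℚ)⁻¹ * coeff p (logSeries ^ 5) := by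
  obtain ⟨N, hN⟩ := X_pow_dvd_dvdLog p
  have hM := X_pow_dvd_dvdLog p
  have hXM : X ∣ dvdLog p := (dvd_pow_self X hp.ne').trans hM
  have h : X ^ p * X ^ p * X ∣
      primeToLog p ^ 6 - (logSeries ^ 6 - 6 * (logSeries ^ 5 * dvdLog p)) := by
    have e : primeToLog p ^ 6 - (logSeries ^ 6 - 6 * (logSeries ^ 5 * dvdLog p))
        = dvdLog p * dvdLog p * (logSeries * (15 * logSeries ^ 3
          - 20 * logSeries ^ 2 * dvdLog p + 15 * logSeries * dvdLog p ^ 2 - 6 * dvdLog p ^ 3)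
          + dvdLog p * dvdLog p ^ 3) := by
      rw [primeToLog_eq_sub]
      ring
    rw [e]
    exact mul_dvd_mul (mul_dvd_mul hM hM) (dvd_add (X_dvd_logSeries.mul_right _) (hXM.mul_right _))
  rw [← pow_add, ← pow_succ, PowerSeries.X_pow_dvd_iff] at h
  have h2 := h (2 * p) (by lia)
  have hcoeff (j : ℕ) : coeff j N = if p ∣ j then ((j + p : ℕ) : ℚ)⁻¹ else 0 := by
    have := congrArg (coeff (j + p)) hN
    rw [PowerSeries.coeff_X_pow_mul, dvdLog, PowerSeries.coeff_mk] at this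
    rw [← this]
    simp only [Nat.dvd_add_self_right]
  have hprod : coeff (2 * p) (logSeries ^ 5 * dvdLog p) = (p : ℚ)⁻¹ * coeff p (logSeries ^ 5) := by
    rw [hN, mul_left_comm, two_mul, PowerSeries.coeff_X_pow_mul, mul_comm, PowerSeries.coeff_mul,
      Finset.sum_eq_single (0, p)]
    · simp [hcoeff]
    · rintro ⟨i, j⟩ hij hne
      rw [Finset.HasAntidiagonal.mem_antidiagonal] at hij
      simp only at hij ⊢
      rw [hcoeff]
      split_ifs with hd
      · have hi : i = p := by
          rcases Nat.eq_zero_or_pos i with rfl | hi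
          · exact absurd (by simp [← hij]) hne
          · exact le_antisymm (by lia) (Nat.le_of_dvd hi hd)
        have hj : j = 0 := by lia
        simp [hj, logSeries]
      · rw [zero_mul]
    · simp
  have h6 : (6 : PowerSeries ℚ) = PowerSeries.C 6 := (map_ofNat PowerSeries.C 6).symm
  rw [map_sub, sub_eq_zero, map_sub, h6, PowerSeries.coeff_C_mul, hprod] at h2
  rw [h2]
  ring

theorem coeff_prime_primeToLog_pow_six_eq {p : ℕ} (hp : 0 < p) :
    coeff p (primeToLog p ^ 6) = 720 * ((p : ℚ)⁻¹ * (harmonicPoly 0 (p - 1)).coeff 5) := by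
  rw [coeff_prime_primeToLog_pow hp 4, coeff_logSeries_pow_prime 5 hp.ne']
  norm_num [Nat.factorial]
  ring

/-- The factor of `∏ (1 + X / i)`, over `i < 2p`, at `i = p` is split off. -/
theorem coeff_two_mul_prime_primeToLog_pow_six_eq {p : ℕ} (hp : 0 < p) :
    coeff (2 * p) (primeToLog p ^ 6) = 360 * ((p : ℚ)⁻¹ * (p : ℚ)⁻¹ *
      (p * (harmonicPoly 0 (p - 1) * harmonicPoly p (p - 1)).coeff 5
        + (harmonicPoly 0 (p - 1) * harmonicPoly p (p - 1)).coeff 4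
        - 2 * (harmonicPoly 0 (p - 1)).coeff 4)) := by
  have hsplit : harmonicPoly 0 (2 * p - 1) = harmonicPoly 0 (p - 1) * harmonicPoly p (p - 1)
      * (1 + Polynomial.C (p : ℚ)⁻¹ * Polynomial.X) := by
    rw [show 2 * p - 1 = (p - 1 + 1) + (p - 1) by lia, harmonicPoly_add, harmonicPoly_succ,
      show 0 + (p - 1) + 1 = p by lia, show 0 + (p - 1 + 1) = p by lia]
    ring
  have hp0 : (p : ℚ) ≠ 0 := by positivity
  rw [coeff_two_mul_prime_primeToLog_pow_six hp, coeff_logSeries_pow_prime 5 (by lia),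
    coeff_logSeries_pow_prime 4 hp.ne', hsplit, coeff_mul_one_add_C_mul_X_succ]
  norm_num [Nat.factorial]
  field_simp
  ring

end LogSeries

/-! ### Divisibility of the elementary symmetric functions -/

section HarmonicCoefficients

open Polynomial (C X)

variable {p : ℕ} [hp : Fact p.Prime]

/-- The polynomial `∏ (1 + X / a)`, over `0 < a < p`, modulo `p`. -/
noncomputable def harmonicPolyMod (p : ℕ) [Fact p.Prime] : Polynomial (ZMod p) :=
  ∏ a : ZMod p, (1 + C a⁻¹ * X)

theorem sum_range_eq_sum_zmod {M : Type*} [AddCommMonoid M] (f : ZMod p → M) :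
    ∑ i ∈ Finset.range p, f i = ∑ a : ZMod p, f a :=
  Finset.sum_nbij' (fun i ↦ (i : ZMod p)) ZMod.val (fun _ _ ↦ Finset.mem_univ _)
    (fun a _ ↦ Finset.mem_range.2 (ZMod.val_lt a))
    (fun _ hi ↦ ZMod.val_cast_of_lt (Finset.mem_range.1 hi)) (fun a _ ↦ ZMod.natCast_zmod_val a)
    (fun _ _ ↦ rfl)

theorem prod_range_eq_prod_zmod {M : Type*} [CommMonoid M] (f : ZMod p → M) :
    ∏ i ∈ Finset.range p, f i = ∏ a : ZMod p, f a :=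
  Finset.prod_nbij' (fun i ↦ (i : ZMod p)) ZMod.val (fun _ _ ↦ Finset.mem_univ _)
    (fun a _ ↦ Finset.mem_range.2 (ZMod.val_lt a))
    (fun _ hi ↦ ZMod.val_cast_of_lt (Finset.mem_range.1 hi)) (fun a _ ↦ ZMod.natCast_zmod_val a)
    (fun _ _ ↦ rfl)

/-- The polynomial is invariant under `X ↦ x X` for every unit `x`. -/
theorem coeff_harmonicPolyMod {k : ℕ} (hk : 0 < k) (hkp : k < p - 1) :
    (harmonicPolyMod p).coeff k = 0 := by
  obtain ⟨x, hx0, hx⟩ := exists_pow_ne_one hk hkp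
  have h : (harmonicPolyMod p).comp (C x * X) = harmonicPolyMod p := by
    rw [harmonicPolyMod, Polynomial.prod_comp, ← Equiv.prod_comp (Equiv.mulLeft₀ x hx0)]
    refine Finset.prod_congr rfl fun a _ ↦ ?_
    simp only [Polynomial.add_comp, Polynomial.one_comp, Polynomial.mul_comp, Polynomial.C_comp,
      Polynomial.X_comp, Equiv.mulLeft₀_apply, ← mul_assoc, ← map_mul]
    rw [mul_inv, mul_right_comm, inv_mul_cancel₀ hx0, one_mul]
  have hc := congrArg (fun P ↦ P.coeff k) h
  simp only [Polynomial.comp_C_mul_X_coeff] at hc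
  have h' : (harmonicPolyMod p).coeff k * (x ^ k - 1) = 0 := by linear_combination hc
  exact (mul_eq_zero.1 h').resolve_right (sub_ne_zero.2 hx)

theorem not_dvd_add_one {p i : ℕ} (hi : i ∈ Finset.range (p - 1)) : ¬ p ∣ i + 1 :=
  Nat.not_dvd_of_pos_of_lt i.succ_pos (by have := Finset.mem_range.1 hi; lia)

/-- A common lift to `ℤ_(p)` of the rational polynomial and of its reduction modulo `p`. -/
theorem exists_lift_harmonicPoly : ∃ P : Polynomial (localInt p),
    P.map (localInt p).subtype = harmonicPoly 0 (p - 1) ∧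
      P.map (localRed p) = harmonicPolyMod p := by
  let c (a : ℕ) : localInt p := if h : p ∣ a then 0 else ⟨(a : ℚ)⁻¹, natCast_inv_mem_localInt h⟩
  have hc (a : ℕ) : localRed p (c a) = (a : ZMod p)⁻¹ := by
    by_cases h : p ∣ a
    · simp [c, h, (ZMod.natCast_eq_zero_iff a p).2 h]
    · simp only [c, h, dite_false]
      exact localRed_inv h
  refine ⟨∏ i ∈ Finset.range (p - 1), (1 + C (c (i + 1)) * X), ?_, ?_⟩
  · rw [Polynomial.map_prod, harmonicPoly]
    refine Finset.prod_congr rfl fun i hi ↦ ?_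
    simp [c, not_dvd_add_one hi]
  · rw [Polynomial.map_prod, harmonicPolyMod, ← prod_range_eq_prod_zmod]
    have hr : Finset.range p = Finset.range (p - 1 + 1) := by
      rw [Nat.sub_add_cancel hp.out.one_le]
    rw [hr, Finset.prod_range_succ']
    simp [hc]

theorem coeff_harmonicPoly_mem_zero (k : ℕ) :
    (harmonicPoly 0 (p - 1)).coeff k ∈ padicFil p 0 := by
  obtain ⟨P, h, -⟩ := exists_lift_harmonicPoly (p := p)
  rw [← h, Polynomial.coeff_map]
  exact mem_padicFil_zero.2 (P.coeff k).2

theorem coeff_harmonicPoly_mem_one {k : ℕ} (hk : 0 < k) (hkp : k < p - 1) :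
    (harmonicPoly 0 (p - 1)).coeff k ∈ padicFil p 1 := by
  obtain ⟨P, h, h'⟩ := exists_lift_harmonicPoly (p := p)
  rw [← h, Polynomial.coeff_map]
  refine (mem_padicFil_one_iff _).2 ?_
  rw [← Polynomial.coeff_map, h', coeff_harmonicPolyMod hk hkp]

theorem coeff_harmonicPoly_prime_mem_zero (k : ℕ) :
    (harmonicPoly p (p - 1)).coeff k ∈ padicFil p 0 := by
  have key (n : ℕ) (hn : n ≤ p - 1) (k : ℕ) : (harmonicPoly p n).coeff k ∈ padicFil p 0 := by
    induction n generalizing k with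
    | zero =>
      rw [harmonicPoly, Finset.range_zero, Finset.prod_empty, Polynomial.coeff_one]
      split_ifs
      · exact mem_padicFil_zero.2 (one_mem _)
      · exact zero_mem _
    | succ n ih =>
      cases k with
      | zero =>
        rw [coeff_zero_harmonicPoly]
        exact mem_padicFil_zero.2 (one_mem _)
      | succ k =>
        rw [harmonicPoly_succ, coeff_mul_one_add_C_mul_X_succ]
        refine add_mem (ih (by lia) _) (mul_mem_padicFil (natCast_inv_mem_padicFil_zero ?_)
          (ih (by lia) k) rfl)
        rw [add_assoc, Nat.dvd_add_right dvd_rfl]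
        exact not_dvd_add_one (Finset.mem_range.2 (by lia))
  exact key _ le_rfl k

theorem eval_mem_padicFil_zero {P : Polynomial ℚ} (hP : ∀ k, P.coeff k ∈ padicFil p 0) :
    P.eval (p : ℚ) ∈ padicFil p 0 := by
  rw [Polynomial.eval_eq_sum]
  refine sum_mem fun k _ ↦ mul_mem_padicFil (l := 0) (hP k) ?_ rfl
  exact_mod_cast natCast_mem_padicFil_zero (p ^ k)

theorem eval_eq_coeff_zero_add (P : Polynomial ℚ) (x : ℚ) :
    P.eval x = P.coeff 0 + x * P.divX.eval x := by
  conv_lhs => rw [← Polynomial.divX_mul_X_add P]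
  simp
  ring

theorem eval_prime_sub_mem {P : Polynomial ℚ} (hP : ∀ k, P.coeff k ∈ padicFil p 0) :
    P.eval (p : ℚ) - (P.coeff 0 + p * P.coeff 1 + p ^ 2 * P.coeff 2) ∈ padicFil p 3 := by
  have h : P.eval (p : ℚ) - (P.coeff 0 + p * P.coeff 1 + p ^ 2 * P.coeff 2)
      = p ^ 3 * P.divX.divX.divX.eval (p : ℚ) := by
    rw [eval_eq_coeff_zero_add P, eval_eq_coeff_zero_add P.divX, eval_eq_coeff_zero_add P.divX.divX]
    simp only [Polynomial.coeff_divX]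
    ring
  rw [h]
  refine mul_mem_padicFil (pow_mem_padicFil 3) (eval_mem_padicFil_zero fun k ↦ ?_) rfl
  simp only [Polynomial.coeff_divX]
  exact hP _

/-- Second order Taylor expansion, modulo `p ^ 3`, of the coefficients of `P (X + p)`. -/
theorem coeff_taylor_sub_mem {P : Polynomial ℚ} (hP : ∀ k, P.coeff k ∈ padicFil p 0) (i : ℕ) :
    (Polynomial.taylor (p : ℚ) P).coeff i - (P.coeff i
      + p * (((i + 1).choose i : ℕ) * P.coeff (i + 1))
      + p ^ 2 * (((i + 2).choose i : ℕ) * P.coeff (i + 2))) ∈ padicFil p 3 := by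
  have h := eval_prime_sub_mem (P := Polynomial.hasseDeriv i P) fun k ↦ by
    rw [Polynomial.hasseDeriv_coeff]
    exact natCast_mul_mem_padicFil _ (hP _)
  rw [Polynomial.taylor_coeff]
  simp only [Polynomial.hasseDeriv_coeff] at h
  simpa [add_comm] using h

/-- The symmetry `g (-X - p) = g X` of `g = ∏ (1 + X / a)`, from `a ↦ p - a`. -/
theorem taylor_comp_neg_harmonicPoly {p : ℕ} (hodd : Even (p - 1)) :
    Polynomial.taylor (p : ℚ) ((harmonicPoly 0 (p - 1)).comp (-X)) = harmonicPoly 0 (p - 1) := by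
  have hfac (i : ℕ) (hi : i ∈ Finset.range (p - 1)) :
      1 + C (((0 + i + 1 : ℕ) : ℚ)⁻¹) * (-(X + C (p : ℚ)))
        = C (-1) * C (((p - 1 - 1 - i + 1 : ℕ) : ℚ) * ((i + 1 : ℕ) : ℚ)⁻¹)
          * (1 + C ((p - 1 - 1 - i + 1 : ℕ) : ℚ)⁻¹ * X) := by
    have hi' := Finset.mem_range.1 hi
    have e : p - 1 - 1 - i + 1 = p - (i + 1) := by lia
    have h1 : ((i + 1 : ℕ) : ℚ) ≠ 0 := by positivity
    have h2 : ((p - (i + 1) : ℕ) : ℚ) ≠ 0 := by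
      have : 0 < p - (i + 1) := by lia
      positivity
    have e2 : ((p - (i + 1) : ℕ) : ℚ) = p - ((i + 1 : ℕ) : ℚ) := Nat.cast_sub (by lia)
    have h3 : C (((p - (i + 1) : ℕ) : ℚ) * ((i + 1 : ℕ) : ℚ)⁻¹) * C ((p - (i + 1) : ℕ) : ℚ)⁻¹
        = C ((i + 1 : ℕ) : ℚ)⁻¹ := by
      rw [← map_mul]
      congr 1
      field_simp
    have h4 : C (((p - (i + 1) : ℕ) : ℚ) * ((i + 1 : ℕ) : ℚ)⁻¹)
        = C ((i + 1 : ℕ) : ℚ)⁻¹ * C (p : ℚ) - 1 := by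
      rw [← map_mul, ← map_one C, ← map_sub, e2]
      congr 1
      field_simp
    rw [e, zero_add, map_neg, map_one]
    linear_combination h4 + X * h3
  rw [Polynomial.taylor_apply, harmonicPoly, Polynomial.prod_comp, Polynomial.prod_comp]
  simp only [Polynomial.add_comp, Polynomial.one_comp, Polynomial.mul_comp, Polynomial.C_comp,
    Polynomial.X_comp, Polynomial.neg_comp]
  rw [Finset.prod_congr rfl hfac, Finset.prod_mul_distrib, Finset.prod_mul_distrib,
    Finset.prod_const, Finset.card_range, map_neg, map_one, hodd.neg_one_pow, one_mul, ← map_prod,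
    Finset.prod_mul_distrib,
    Finset.prod_range_reflect (fun i ↦ ((i + 1 : ℕ) : ℚ)),
    Finset.prod_range_reflect (fun i ↦ 1 + C ((i + 1 : ℕ) : ℚ)⁻¹ * X), ← Finset.prod_mul_distrib,
    Finset.prod_eq_one fun i _ ↦ mul_inv_cancel₀ (by positivity), map_one, one_mul]
  simp

/-- The product over the block `p < i < 2p` is a normalized translate of the one over
`0 < a < p`. -/
theorem taylor_harmonicPoly (p : ℕ) : Polynomial.taylor (p : ℚ) (harmonicPoly 0 (p - 1))
    = C ((harmonicPoly 0 (p - 1)).eval (p : ℚ)) * harmonicPoly p (p - 1) := by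
  rw [Polynomial.taylor_apply, harmonicPoly, Polynomial.prod_comp, Polynomial.eval_prod, map_prod,
    harmonicPoly, ← Finset.prod_mul_distrib]
  refine Finset.prod_congr rfl fun i _ ↦ ?_
  simp only [Polynomial.add_comp, Polynomial.one_comp, Polynomial.mul_comp, Polynomial.C_comp,
    Polynomial.X_comp, Polynomial.eval_add, Polynomial.eval_one, Polynomial.eval_mul,
    Polynomial.eval_C, Polynomial.eval_X]
  have h1 : ((0 + i + 1 : ℕ) : ℚ) ≠ 0 := by positivity
  have h2 : ((p + i + 1 : ℕ) : ℚ) ≠ 0 := by positivity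
  have h3 : C (1 + ((0 + i + 1 : ℕ) : ℚ)⁻¹ * p) * C ((p + i + 1 : ℕ) : ℚ)⁻¹
      = C ((0 + i + 1 : ℕ) : ℚ)⁻¹ := by
    rw [← map_mul]
    congr 1
    field_simp
    push_cast
    ring
  rw [map_add, map_one, map_mul] at h3 ⊢
  linear_combination -X * h3

/-- In odd degree `k`, comparing coefficients in `g (-X - p) = g X` gives twice the coefficient as
`p (k + 1)` times the next one, up to multiples of `p ^ 2`. -/
theorem coeff_harmonicPoly_mem_two {k : ℕ} (hk : Odd k) (hkp : k + 1 < p - 1) :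
    (harmonicPoly 0 (p - 1)).coeff k ∈ padicFil p 2 := by
  have hp2 : Odd p := hp.out.odd_of_ne_two (by lia)
  have hev : Even (p - 1) := Nat.Odd.sub_odd hp2 odd_one
  have hc (j : ℕ) : ((harmonicPoly 0 (p - 1)).comp (-X)).coeff j
      = (-1) ^ j * (harmonicPoly 0 (p - 1)).coeff j := by
    have hX : (-X : Polynomial ℚ) = C (-1) * X := by simp
    rw [hX, Polynomial.comp_C_mul_X_coeff, mul_comm]
  have h := coeff_taylor_sub_mem (p := p) (P := (harmonicPoly 0 (p - 1)).comp (-X)) (fun j ↦ by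
    rw [hc]
    refine mul_mem_padicFil (k := 0) ?_ (coeff_harmonicPoly_mem_zero j) rfl
    exact mem_padicFil_zero.2 (pow_mem (neg_mem (one_mem _)) j)) k
  rw [taylor_comp_neg_harmonicPoly hev, hc, hc, hc, hk.neg_one_pow, hk.add_one.neg_one_pow,
    show k + 2 = k + 1 + 1 from rfl, hk.add_one.add_one.neg_one_pow] at h
  refine mem_padicFil_of_natCast_mul (a := 2) (Nat.not_dvd_of_pos_of_lt two_pos (by lia)) ?_
  have h1 : (p : ℚ) * (((k + 1).choose k : ℕ) * (harmonicPoly 0 (p - 1)).coeff (k + 1))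
      ∈ padicFil p 2 := mul_mem_padicFil prime_mem_padicFil (natCast_mul_mem_padicFil _
        (coeff_harmonicPoly_mem_one (by lia) hkp)) (by norm_num)
  have h2 : (p : ℚ) ^ 2 * (((k + 2).choose k : ℕ) * (harmonicPoly 0 (p - 1)).coeff (k + 2))
      ∈ padicFil p 2 := mul_mem_padicFil (pow_mem_padicFil 2) (natCast_mul_mem_padicFil _
        (coeff_harmonicPoly_mem_zero _)) (by norm_num)
  convert sub_mem (add_mem (padicFil_mono (by norm_num) h) h1) h2 using 1
  push_cast
  ring

end HarmonicCoefficients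

/-! ### The coefficients at `p` and `2p` -/

section Values

variable {p : ℕ} [hp : Fact p.Prime]

theorem eval_harmonicPoly_sub_one_mem (hp11 : 11 ≤ p) :
    (harmonicPoly 0 (p - 1)).eval (p : ℚ) - 1 ∈ padicFil p 3 := by
  have h := eval_prime_sub_mem (p := p) (coeff_harmonicPoly_mem_zero (p := p))
  rw [coeff_zero_harmonicPoly] at h
  have h1 : (p : ℚ) * (harmonicPoly 0 (p - 1)).coeff 1 ∈ padicFil p 3 :=
    mul_mem_padicFil prime_mem_padicFil (coeff_harmonicPoly_mem_two odd_one (by lia)) (by norm_num)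
  have h2 : (p : ℚ) ^ 2 * (harmonicPoly 0 (p - 1)).coeff 2 ∈ padicFil p 3 :=
    mul_mem_padicFil (pow_mem_padicFil 2) (coeff_harmonicPoly_mem_one two_pos (by lia))
      (by norm_num)
  convert add_mem (add_mem h h1) h2 using 1
  ring

theorem coeff_harmonicPoly_prime_sub_mem (hp11 : 11 ≤ p) (i : ℕ) :
    (harmonicPoly p (p - 1)).coeff i - ((harmonicPoly 0 (p - 1)).coeff i
      + p * (((i + 1).choose i : ℕ) * (harmonicPoly 0 (p - 1)).coeff (i + 1))
      + p ^ 2 * (((i + 2).choose i : ℕ) * (harmonicPoly 0 (p - 1)).coeff (i + 2)))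
      ∈ padicFil p 3 := by
  have h := coeff_taylor_sub_mem (p := p) (coeff_harmonicPoly_mem_zero (p := p)) i
  rw [taylor_harmonicPoly, Polynomial.coeff_C_mul] at h
  have h1 := mul_mem_padicFil (eval_harmonicPoly_sub_one_mem hp11)
    (coeff_harmonicPoly_prime_mem_zero (p := p) i) (m := 3) (by norm_num)
  convert sub_mem h h1 using 1
  ring

theorem coeff_harmonicPoly_prime_sub_mem_two (hp11 : 11 ≤ p) {i : ℕ} (hi : i + 1 < p - 1) :
    (harmonicPoly p (p - 1)).coeff i - (harmonicPoly 0 (p - 1)).coeff i ∈ padicFil p 2 := by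
  have h := padicFil_mono (l := 2) (by norm_num) (coeff_harmonicPoly_prime_sub_mem hp11 i)
  have h1 : (p : ℚ) * (((i + 1).choose i : ℕ) * (harmonicPoly 0 (p - 1)).coeff (i + 1))
      ∈ padicFil p 2 := mul_mem_padicFil prime_mem_padicFil (natCast_mul_mem_padicFil _
        (coeff_harmonicPoly_mem_one (by lia) hi)) (by norm_num)
  have h2 : (p : ℚ) ^ 2 * (((i + 2).choose i : ℕ) * (harmonicPoly 0 (p - 1)).coeff (i + 2))
      ∈ padicFil p 2 := mul_mem_padicFil (pow_mem_padicFil 2) (natCast_mul_mem_padicFil _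
        (coeff_harmonicPoly_mem_zero _)) (by norm_num)
  convert add_mem (add_mem h h1) h2 using 1
  ring

theorem coeff_harmonicPoly_prime_mem_one (hp11 : 11 ≤ p) {i : ℕ} (h0 : 0 < i)
    (hi : i + 1 < p - 1) : (harmonicPoly p (p - 1)).coeff i ∈ padicFil p 1 := by
  have h := add_mem (padicFil_mono (l := 1) (by norm_num)
    (coeff_harmonicPoly_prime_sub_mem_two hp11 hi)) (coeff_harmonicPoly_mem_one h0 (by lia))
  rwa [sub_add_cancel] at h

theorem coeff_harmonicPoly_prime_mem_two (hp11 : 11 ≤ p) {i : ℕ} (h0 : Odd i)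
    (hi : i + 1 < p - 1) : (harmonicPoly p (p - 1)).coeff i ∈ padicFil p 2 := by
  have h := add_mem (coeff_harmonicPoly_prime_sub_mem_two hp11 hi)
    (coeff_harmonicPoly_mem_two h0 hi)
  rwa [sub_add_cancel] at h

theorem coeff_four_harmonicPoly_prime_sub_mem_three (hp11 : 11 ≤ p) :
    (harmonicPoly p (p - 1)).coeff 4 - (harmonicPoly 0 (p - 1)).coeff 4 ∈ padicFil p 3 := by
  have h := coeff_harmonicPoly_prime_sub_mem hp11 4
  have h1 : (p : ℚ) * (((4 + 1).choose 4 : ℕ) * (harmonicPoly 0 (p - 1)).coeff (4 + 1))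
      ∈ padicFil p 3 := mul_mem_padicFil prime_mem_padicFil (natCast_mul_mem_padicFil _
        (coeff_harmonicPoly_mem_two (by decide) (by lia))) (by norm_num)
  have h2 : (p : ℚ) ^ 2 * (((4 + 2).choose 4 : ℕ) * (harmonicPoly 0 (p - 1)).coeff (4 + 2))
      ∈ padicFil p 3 := mul_mem_padicFil (pow_mem_padicFil 2) (natCast_mul_mem_padicFil _
        (coeff_harmonicPoly_mem_one (by norm_num) (by lia))) (by norm_num)
  convert add_mem (add_mem h h1) h2 using 1
  ring

/-- This is `6! e₅ / p` with `p ^ 2 ∣ e₅`. -/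
theorem coeff_prime_primeToLog_pow_six_mem (hp11 : 11 ≤ p) :
    PowerSeries.coeff p (primeToLog p ^ 6) ∈ padicFil p 1 := by
  rw [coeff_prime_primeToLog_pow_six_eq hp.out.pos]
  exact_mod_cast natCast_mul_mem_padicFil 720 (mul_mem_padicFil prime_inv_mem_padicFil
    (coeff_harmonicPoly_mem_two (k := 5) (by decide) (by lia)) (by norm_num))

/-- Of the products in the two coefficients of the product of the two blocks, only the square of
the second elementary symmetric function survives division by `p ^ 2`. -/
theorem coeff_two_mul_prime_primeToLog_pow_six_sub_mem (hp11 : 11 ≤ p) :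
    PowerSeries.coeff (2 * p) (primeToLog p ^ 6)
      - 360 * ((p : ℚ)⁻¹ * (harmonicPoly 0 (p - 1)).coeff 2) ^ 2 ∈ padicFil p 1 := by
  rw [coeff_two_mul_prime_primeToLog_pow_six_eq hp.out.pos]
  set g := harmonicPoly 0 (p - 1) with hg
  set h := harmonicPoly p (p - 1) with hh
  have g0 : g.coeff 0 = 1 := coeff_zero_harmonicPoly _ _
  have h0 : h.coeff 0 = 1 := coeff_zero_harmonicPoly _ _
  have g1 : g.coeff 1 ∈ padicFil p 2 := coeff_harmonicPoly_mem_two odd_one (by lia)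
  have g2 : g.coeff 2 ∈ padicFil p 1 := coeff_harmonicPoly_mem_one (by norm_num) (by lia)
  have g3 : g.coeff 3 ∈ padicFil p 2 := coeff_harmonicPoly_mem_two (by decide) (by lia)
  have g4 : g.coeff 4 ∈ padicFil p 1 := coeff_harmonicPoly_mem_one (by norm_num) (by lia)
  have g5 : g.coeff 5 ∈ padicFil p 2 := coeff_harmonicPoly_mem_two (by decide) (by lia)
  have h1 : h.coeff 1 ∈ padicFil p 2 := coeff_harmonicPoly_prime_mem_two hp11 odd_one (by lia)
  have h2 : h.coeff 2 ∈ padicFil p 1 :=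
    coeff_harmonicPoly_prime_mem_one hp11 (by norm_num) (by lia)
  have h3 : h.coeff 3 ∈ padicFil p 2 := coeff_harmonicPoly_prime_mem_two hp11 (by decide) (by lia)
  have h4 : h.coeff 4 ∈ padicFil p 1 :=
    coeff_harmonicPoly_prime_mem_one hp11 (by norm_num) (by lia)
  have h5 : h.coeff 5 ∈ padicFil p 2 := coeff_harmonicPoly_prime_mem_two hp11 (by decide) (by lia)
  have h22 : h.coeff 2 - g.coeff 2 ∈ padicFil p 2 :=
    coeff_harmonicPoly_prime_sub_mem_two hp11 (by lia)
  have h44 : h.coeff 4 - g.coeff 4 ∈ padicFil p 3 :=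
    coeff_four_harmonicPoly_prime_sub_mem_three hp11
  have c5 : (g * h).coeff 5 ∈ padicFil p 2 := by
    have e : (g * h).coeff 5 = h.coeff 5 + g.coeff 1 * h.coeff 4 + g.coeff 2 * h.coeff 3
        + g.coeff 3 * h.coeff 2 + g.coeff 4 * h.coeff 1 + g.coeff 5 := by
      simp [Polynomial.coeff_mul, Finset.Nat.antidiagonal_succ, g0, h0]
      ring
    rw [e]
    exact add_mem (add_mem (add_mem (add_mem (add_mem h5
      (padicFil_mono (by norm_num) (mul_mem_padicFil g1 h4 rfl)))
      (padicFil_mono (by norm_num) (mul_mem_padicFil g2 h3 rfl)))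
      (padicFil_mono (by norm_num) (mul_mem_padicFil g3 h2 rfl)))
      (padicFil_mono (by norm_num) (mul_mem_padicFil g4 h1 rfl))) g5
  have c4 : (g * h).coeff 4 - 2 * g.coeff 4 - g.coeff 2 ^ 2 ∈ padicFil p 3 := by
    have e : (g * h).coeff 4 - 2 * g.coeff 4 - g.coeff 2 ^ 2
        = (h.coeff 4 - g.coeff 4) + g.coeff 1 * h.coeff 3 + g.coeff 2 * (h.coeff 2 - g.coeff 2)
        + g.coeff 3 * h.coeff 1 := by
      simp [Polynomial.coeff_mul, Finset.Nat.antidiagonal_succ, g0, h0]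
      ring
    rw [e]
    exact add_mem (add_mem (add_mem h44
      (padicFil_mono (by norm_num) (mul_mem_padicFil g1 h3 rfl)))
      (mul_mem_padicFil g2 h22 (by norm_num)))
      (padicFil_mono (by norm_num) (mul_mem_padicFil g3 h1 rfl))
  have key := natCast_mul_mem_padicFil 360 (mul_mem_padicFil
    (mul_mem_padicFil prime_inv_mem_padicFil prime_inv_mem_padicFil rfl)
    (add_mem (mul_mem_padicFil prime_mem_padicFil c5 (m := 3) (by norm_num)) c4)
    (m := 1) (by norm_num))
  convert key using 1
  push_cast
  ring

end Values

/-! ### Bernoulli numbers and harmonic sums modulo `p` -/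

section Bernoulli

variable {p : ℕ} [hp : Fact p.Prime]

theorem bernoulli'_mem_localInt {n : ℕ} (hn : n + 1 < p) : bernoulli' n ∈ localInt p := by
  induction n using Nat.strong_induction_on with
  | _ n ih =>
    rw [bernoulli'_def]
    refine sub_mem (one_mem _) (sum_mem fun k hk ↦ mul_mem ?_ ?_)
    · have hk' := Finset.mem_range.1 hk
      rw [div_eq_mul_inv]
      refine mul_mem (natCast_mem _ _) ?_
      have := natCast_inv_mem_localInt (p := p) (a := n - k + 1)
        (Nat.not_dvd_of_pos_of_lt (by lia) (by lia))
      push_cast [hk'.le] at this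
      exact this
    · have hk' := Finset.mem_range.1 hk
      exact ih k hk' (by lia)

theorem bernoulli_mem_localInt {n : ℕ} (hn : n + 1 < p) : bernoulli n ∈ localInt p :=
  mul_mem (pow_mem (neg_mem (one_mem _)) _) (bernoulli'_mem_localInt hn)

/-- The reduction modulo `p` of the Bernoulli number `B_n`, meant for `n + 1 < p`, where `B_n` is
`p`-integral. -/
noncomputable def bernoulliMod (p : ℕ) [Fact p.Prime] (n : ℕ) : ZMod p :=
  (bernoulli n : ZMod p)

theorem localRed_bernoulli {n : ℕ} (hn : n + 1 < p) :
    localRed p ⟨bernoulli n, bernoulli_mem_localInt hn⟩ = bernoulliMod p n := rfl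

/-- Faulhaber's formula modulo `p`. -/
theorem neg_sum_range_pow_mod (hp2 : 2 < p) (m : ℕ) :
    -∑ i ∈ Finset.range m, (i : ZMod p) ^ (p - 2)
      = ∑ j ∈ Finset.range (p - 1),
        bernoulliMod p j * (p - 1).choose j * (m : ZMod p) ^ (p - 1 - j) := by
  have hex : p - 2 + 1 = p - 1 := by lia
  have hq : (p - 1 : ℕ) * ∑ i ∈ Finset.range m, (i : ℚ) ^ (p - 2)
      = ∑ j ∈ Finset.range (p - 1), bernoulli j * (p - 1).choose j * (m : ℚ) ^ (p - 1 - j) := by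
    have h0 : ((p - 1 : ℕ) : ℚ) ≠ 0 := by
      have : 0 < p - 1 := by lia
      positivity
    have hc : ((p - 2 : ℕ) : ℚ) + 1 = (p - 1 : ℕ) := by
      rw [← hex]
      push_cast
      ring
    rw [sum_range_pow, hex, hc, ← Finset.sum_div, mul_div_cancel₀ _ h0]
  have hR : ((p - 1 : ℕ) : localInt p) * ∑ i ∈ Finset.range m, (i : localInt p) ^ (p - 2)
      = ∑ j : Finset.range (p - 1), ⟨bernoulli j, bernoulli_mem_localInt
        (by have := Finset.mem_range.1 j.2; lia)⟩ * ((p - 1).choose j : localInt p)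
          * (m : localInt p) ^ (p - 1 - j) := by
    apply (localInt p).subtype_injective
    refine Eq.trans ?_ (hq.trans ?_)
    · simp
    · rw [← Finset.sum_coe_sort]
      simp
  have hz := congrArg (localRed p) hR
  simp only [map_mul, map_sum, map_pow, map_natCast] at hz
  rw [← Finset.sum_coe_sort (Finset.range (p - 1))]
  refine Eq.trans ?_ hz
  rw [Nat.cast_sub hp.out.one_le, CharP.cast_eq_zero]
  simp

theorem inv_eq_pow_mod (hp2 : 2 < p) (a : ZMod p) : a⁻¹ = a ^ (p - 2) := by
  rcases eq_or_ne a 0 with rfl | ha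
  · rw [inv_zero, zero_pow (by lia)]
  · refine inv_eq_of_mul_eq_one_left ?_
    rw [← pow_succ, show p - 2 + 1 = p - 1 by lia, ZMod.pow_card_sub_one_eq_one ha]

theorem sum_pow_mod_eq_zero {k : ℕ} (hk : k < p - 1) : ∑ a : ZMod p, a ^ k = 0 :=
  FiniteField.sum_pow_lt_card_sub_one _ _ (by rwa [ZMod.card])

theorem choose_prime_sub_one_mod (hp2 : 2 < p) : ((p - 1).choose (p - 3) : ZMod p) = 1 := by
  have h2 : (2 : ZMod p) ≠ 0 := by
    have := (ZMod.natCast_eq_zero_iff 2 p).not.2 (Nat.not_dvd_of_pos_of_lt two_pos hp2)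
    exact_mod_cast this
  have h : (p - 1).choose (p - 3) * 2 = (p - 1) * (p - 2) := by
    rw [← Nat.choose_symm (show p - 3 ≤ p - 1 by lia), show p - 1 - (p - 3) = 2 by lia,
      Nat.choose_two_right, Nat.div_mul_cancel (Nat.even_mul_pred_self _).two_dvd]
    rfl
  have h' := congrArg (Nat.cast (R := ZMod p)) h
  rw [Nat.cast_mul, Nat.cast_mul, Nat.cast_sub (by lia), Nat.cast_sub (by lia),
    CharP.cast_eq_zero (ZMod p) p] at h'
  refine mul_right_cancel₀ h2 ?_
  push_cast at h'
  linear_combination h'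

/-- Faulhaber's formula turns the inner sum into a polynomial in `m`; after division by `m ^ 2`,
only the term of degree `p - 1 - (p - 3) = 2` has a nonzero sum over `m`. -/
theorem sum_inv_sq_mul_sum_inv (hp5 : 5 ≤ p) :
    ∑ m ∈ Finset.range p, (m : ZMod p)⁻¹ ^ 2 * ∑ i ∈ Finset.range m, (i : ZMod p)⁻¹
      = bernoulliMod p (p - 3) := by
  have h1 (m : ℕ) : (m : ZMod p)⁻¹ ^ 2 * ∑ i ∈ Finset.range m, (i : ZMod p)⁻¹
      = -∑ j ∈ Finset.range (p - 1), bernoulliMod p j * (p - 1).choose j *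
        ((m : ZMod p)⁻¹ ^ 2 * (m : ZMod p) ^ (p - 1 - j)) := by
    simp only [inv_eq_pow_mod (show 2 < p by lia) ((_ : ℕ) : ZMod p)]
    rw [← neg_neg (∑ i ∈ Finset.range m, _), neg_sum_range_pow_mod (by lia), mul_neg,
      Finset.mul_sum]
    congr 1
    exact Finset.sum_congr rfl fun j _ ↦ by ring
  have h2 (j : ℕ) (hj : j ∈ Finset.range (p - 1)) :
      ∑ m : ZMod p, m⁻¹ ^ 2 * m ^ (p - 1 - j) = if j = p - 3 then -1 else 0 := by
    have hj' := Finset.mem_range.1 hj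
    rcases lt_trichotomy j (p - 3) with h | h | h
    · rw [if_neg h.ne, ← sum_pow_mod_eq_zero (p := p) (k := p - 3 - j) (by lia)]
      refine Finset.sum_congr rfl fun m _ ↦ ?_
      rcases eq_or_ne m 0 with rfl | hm
      · rw [zero_pow (by lia), zero_pow (by lia), mul_zero]
      · rw [show p - 1 - j = p - 3 - j + 2 by lia, pow_add]
        field_simp
    · rw [if_pos h, show p - 1 - j = 2 by lia]
      have : ∀ m : ZMod p, m⁻¹ ^ 2 * m ^ 2 = 1 - if m = 0 then 1 else 0 := fun m ↦ by
        rcases eq_or_ne m 0 with rfl | hm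
        · simp
        · rw [← mul_pow, inv_mul_cancel₀ hm, one_pow, if_neg hm, sub_zero]
      simp only [this]
      rw [Finset.sum_sub_distrib, Finset.sum_ite_eq' Finset.univ (0 : ZMod p)]
      simp
    · rw [if_neg h.ne', ← sum_pow_mod_eq_zero (p := p) (k := p - 2) (by lia)]
      refine Finset.sum_congr rfl fun m _ ↦ ?_
      rw [show p - 1 - j = 1 by lia, ← inv_eq_pow_mod (by lia)]
      rcases eq_or_ne m 0 with rfl | hm
      · simp
      · field_simp
  simp only [h1]
  rw [Finset.sum_neg_distrib, Finset.sum_comm]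
  simp only [← Finset.mul_sum]
  rw [Finset.sum_congr rfl fun j hj ↦ by
    rw [sum_range_eq_sum_zmod (fun m : ZMod p ↦ m⁻¹ ^ 2 * m ^ (p - 1 - j)), h2 j hj]]
  simp only [mul_ite, mul_zero]
  rw [Finset.sum_ite_eq' (Finset.range (p - 1)) (p - 3), if_pos (Finset.mem_range.2 (by lia)),
    choose_prime_sub_one_mod (by lia)]
  ring

end Bernoulli

/-! ### The second elementary symmetric function modulo `p ^ 2` -/

section CubeCoefficient

variable {p : ℕ} [hp : Fact p.Prime]

/-- Partial fractions: `1 / (i j) = (1 / i + 1 / j) / (i + j)`. -/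
theorem coeff_primeToLogMod_sq {m : ℕ} (hm : m < p) :
    PowerSeries.coeff m (primeToLogMod p ^ 2)
      = 2 * (m : ZMod p)⁻¹ * ∑ i ∈ Finset.range m, (i : ZMod p)⁻¹ := by
  have hne (i : ℕ) (h0 : 0 < i) (hi : i < p) : (i : ZMod p) ≠ 0 := by
    rw [Ne, ZMod.natCast_eq_zero_iff]
    exact Nat.not_dvd_of_pos_of_lt h0 hi
  rw [sq, PowerSeries.coeff_mul, Finset.Nat.sum_antidiagonal_eq_sum_range_succ
    (fun i j ↦ PowerSeries.coeff i (primeToLogMod p) * PowerSeries.coeff j (primeToLogMod p))]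
  simp only [primeToLogMod, PowerSeries.coeff_mk]
  cases m with
  | zero => simp
  | succ n =>
    rw [Finset.sum_range_succ, Finset.sum_range_succ', Finset.sum_range_succ']
    have h1 (i : ℕ) (hi : i ∈ Finset.range n) :
        ((i + 1 : ℕ) : ZMod p)⁻¹ * ((n + 1 - (i + 1) : ℕ) : ZMod p)⁻¹
          = ((n + 1 : ℕ) : ZMod p)⁻¹ *
            (((i + 1 : ℕ) : ZMod p)⁻¹ + ((n - 1 - i + 1 : ℕ) : ZMod p)⁻¹) := by
      have hi' := Finset.mem_range.1 hi
      rw [show n + 1 - (i + 1) = n - 1 - i + 1 by lia]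
      have e : ((n + 1 : ℕ) : ZMod p) = ((i + 1 : ℕ) : ZMod p) + ((n - 1 - i + 1 : ℕ) : ZMod p) :=
          by
        rw [← Nat.cast_add]
        congr 1
        lia
      have a1 := hne (i + 1) (by lia) (by lia)
      have a2 := hne (n - 1 - i + 1) (by lia) (by lia)
      have a3 := hne (n + 1) (by lia) hm
      rw [e] at a3 ⊢
      field_simp
      ring
    rw [Finset.sum_congr rfl h1, ← Finset.mul_sum, Finset.sum_add_distrib,
      Finset.sum_range_reflect (fun i ↦ ((i + 1 : ℕ) : ZMod p)⁻¹)]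
    simp
    ring

theorem coeff_primeToLogMod_cube (hp5 : 5 ≤ p) :
    PowerSeries.coeff p (primeToLogMod p ^ 3) = -2 * bernoulliMod p (p - 3) := by
  rw [pow_succ, PowerSeries.coeff_mul, Finset.Nat.sum_antidiagonal_eq_sum_range_succ
    (fun i j ↦ PowerSeries.coeff i (primeToLogMod p ^ 2) * PowerSeries.coeff j (primeToLogMod p)),
    Finset.sum_range_succ, ← sum_inv_sq_mul_sum_inv hp5, Finset.mul_sum, Nat.sub_self]
  have h0 : PowerSeries.coeff 0 (primeToLogMod p) = 0 := by
    simp [primeToLogMod]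
  rw [h0, mul_zero, add_zero]
  refine Finset.sum_congr rfl fun m hm ↦ ?_
  have hm' := Finset.mem_range.1 hm
  rw [coeff_primeToLogMod_sq hm', primeToLogMod, PowerSeries.coeff_mk, Nat.cast_sub hm'.le,
    CharP.cast_eq_zero (ZMod p) p, zero_sub, inv_neg]
  ring

/-- The congruence `e₂ ≡ -p B_{p-3} / 3` modulo `p ^ 2`, obtained by computing the coefficient of
`X ^ p` in the cube of the logarithm in two ways. -/
theorem three_mul_coeff_two_harmonicPoly_add_mem (hp5 : 5 ≤ p) :
    3 * ((p : ℚ)⁻¹ * (harmonicPoly 0 (p - 1)).coeff 2) + bernoulli (p - 3) ∈ padicFil p 1 := by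
  have hB : p - 3 + 1 < p := by lia
  have h : ((PowerSeries.coeff p (primeToLogLocal p ^ 3)
      + 2 * ⟨bernoulli (p - 3), bernoulli_mem_localInt hB⟩ : localInt p) : ℚ) ∈ padicFil p 1 := by
    rw [mem_padicFil_one_iff, map_add, localRed_coeff_primeToLogLocal_pow, map_mul, map_ofNat,
      localRed_bernoulli hB, coeff_primeToLogMod_cube hp5]
    ring
  refine mem_padicFil_of_natCast_mul (a := 2) (Nat.not_dvd_of_pos_of_lt two_pos (by lia)) ?_
  convert h using 1
  have h2 : ((2 : localInt p) : ℚ) = 2 := rfl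
  rw [Subring.coe_add, Subring.coe_mul, h2, coe_coeff_primeToLogLocal_pow,
    coeff_prime_primeToLog_pow hp.out.pos 1,
    coeff_logSeries_pow_prime 2 hp.out.ne_zero]
  norm_num [Nat.factorial]
  ring

theorem coeff_two_mul_prime_sub_bernoulli_mem (hp11 : 11 ≤ p) :
    PowerSeries.coeff (2 * p) (primeToLog p ^ 6) - 40 * bernoulli (p - 3) ^ 2
      ∈ padicFil p 1 := by
  have h := coeff_two_mul_prime_primeToLog_pow_six_sub_mem hp11
  have h3 := three_mul_coeff_two_harmonicPoly_add_mem (p := p) (by lia)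
  have hB : bernoulli (p - 3) ∈ padicFil p 0 :=
    mem_padicFil_zero.2 (bernoulli_mem_localInt (by lia))
  have hd : 3 * ((p : ℚ)⁻¹ * (harmonicPoly 0 (p - 1)).coeff 2) - bernoulli (p - 3)
      ∈ padicFil p 0 := by
    convert sub_mem (padicFil_mono (l := 0) (by norm_num) h3) (add_mem hB hB) using 1
    ring
  convert add_mem h (natCast_mul_mem_padicFil 40 (mul_mem_padicFil h3 hd (m := 1) (by norm_num)))
    using 1
  push_cast
  ring

end CubeCoefficient

/-! ### Mahler coefficients of the six-variable sum -/

section Conclusion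

variable {p : ℕ} [hp : Fact p.Prime]

/-- The `k`-th Mahler coefficient of the function `N ↦ sixSum p (p N)`. -/
noncomputable def sixSumMahler (p k : ℕ) : ℚ :=
  (fwdDiff p)^[k] (fun n ↦ PowerSeries.coeff n (primeToLog p ^ 6)) 0

theorem sixSum_prime_mul (N : ℕ) :
    sixSum p (p * N) = ∑ k ∈ Finset.range (N + 1), N.choose k * sixSumMahler p k := by
  have h := shift_eq_sum_fwdDiff_iter p (fun n ↦ PowerSeries.coeff n (primeToLog p ^ 6)) N 0
  simp only [zero_add, smul_eq_mul, nsmul_eq_mul] at h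
  rw [sixSum_eq_coeff, mul_comm, h]
  rfl

theorem sixSumMahler_mem (k : ℕ) : sixSumMahler p k ∈ padicFil p (k - 5) :=
  diffDivisible_primeToLog_pow 5 k 0

theorem sixSumMahler_eq (p k : ℕ) : sixSumMahler p k = ∑ j ∈ Finset.range (k + 1),
    ((-1 : ℤ) ^ (k - j) * (k.choose j : ℤ)) • PowerSeries.coeff (j * p) (primeToLog p ^ 6) := by
  have h := fwdDiff_iter_eq_sum_shift p (fun n ↦ PowerSeries.coeff n (primeToLog p ^ 6)) k 0
  rw [sixSumMahler]
  simpa using h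

theorem coeff_zero_primeToLog_pow_six (p : ℕ) : PowerSeries.coeff 0 (primeToLog p ^ 6) = 0 := by
  simp [primeToLog]

/-- The relations modulo `p` among the values at `2p, …, 5p`, lifted to `ℤ_(p)`. -/
theorem coeff_multiples_mem (hp11 : 11 ≤ p) :
    PowerSeries.coeff (3 * p) (primeToLog p ^ 6) - 4 * PowerSeries.coeff (2 * p) (primeToLog p ^ 6)
        ∈ padicFil p 1 ∧
      PowerSeries.coeff (4 * p) (primeToLog p ^ 6)
        - 10 * PowerSeries.coeff (2 * p) (primeToLog p ^ 6) ∈ padicFil p 1 ∧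
      PowerSeries.coeff (5 * p) (primeToLog p ^ 6)
        - 20 * PowerSeries.coeff (2 * p) (primeToLog p ^ 6) ∈ padicFil p 1 := by
  have h1 : PowerSeries.coeff p (primeToLogMod p ^ 6) = 0 := by
    rw [← localRed_coeff_primeToLogLocal_pow, ← mem_padicFil_one_iff, coe_coeff_primeToLogLocal_pow]
    exact coeff_prime_primeToLog_pow_six_mem hp11
  have key (s a : ℕ) (h : PowerSeries.coeff (s * p) (primeToLogMod p ^ 6)
        = (a : ZMod p) * PowerSeries.coeff (2 * p) (primeToLogMod p ^ 6)) :
      PowerSeries.coeff (s * p) (primeToLog p ^ 6)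
        - (a : ℚ) * PowerSeries.coeff (2 * p) (primeToLog p ^ 6) ∈ padicFil p 1 := by
    have := (mem_padicFil_one_iff (PowerSeries.coeff (s * p) (primeToLogLocal p ^ 6)
      - (a : localInt p) * PowerSeries.coeff (2 * p) (primeToLogLocal p ^ 6))).2 (by
        rw [map_sub, map_mul, map_natCast, localRed_coeff_primeToLogLocal_pow,
          localRed_coeff_primeToLogLocal_pow, h, sub_self])
    simpa only [AddSubgroupClass.coe_sub, Subring.coe_mul, Subring.coe_natCast,
      coe_coeff_primeToLogLocal_pow] using this
  obtain ⟨h3, h4, h5⟩ := coeff_primeToLogMod_pow_six hp11 h1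
  exact ⟨key 3 4 (mod_cast h3), key 4 10 (mod_cast h4), key 5 20 (mod_cast h5)⟩

/-- The target polynomial `40 B² (C(N, 2) + C(N, 3))`, by its Mahler coefficients. -/
noncomputable def targetMahler (p k : ℕ) : ℚ :=
  if k = 2 ∨ k = 3 then 40 * bernoulli (p - 3) ^ 2 else 0

theorem sixSumMahler_sub_mem (hp11 : 11 ≤ p) (k : ℕ) :
    sixSumMahler p k - targetMahler p k ∈ padicFil p 1 := by
  have h0 := coeff_zero_primeToLog_pow_six p
  have h1 := coeff_prime_primeToLog_pow_six_mem hp11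
  have h2 := coeff_two_mul_prime_sub_bernoulli_mem hp11
  obtain ⟨h3, h4, h5⟩ := coeff_multiples_mem hp11
  have n (a : ℤ) {x : ℚ} (hx : x ∈ padicFil p 1) : (a : ℚ) * x ∈ padicFil p 1 :=
    mul_mem_padicFil (intCast_mem_padicFil_zero a) hx rfl
  by_cases hk : 6 ≤ k
  · rw [targetMahler, if_neg (by lia), sub_zero]
    exact padicFil_mono (by lia) (sixSumMahler_mem k)
  · rw [sixSumMahler_eq]
    -- in units of the value at `2p`, the values at `0, p, …, 5p` are `0, 0, 1, 4, 10, 20`,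
    -- whose iterated differences at zero are `0, 0, 1, 1, 0, 0`
    interval_cases k <;> simp [Finset.sum_range_succ, targetMahler, Nat.choose, h0]
    · exact h1
    · convert sub_mem h2 (n 2 h1) using 1
      push_cast
      ring
    · convert add_mem (add_mem h3 h2) (n 3 h1) using 1
      push_cast
      ring
    · convert sub_mem (sub_mem h4 (n 4 h3)) (n 4 h1) using 1
      push_cast
      ring
    · convert add_mem (add_mem (sub_mem h5 (n 5 h4)) (n 10 h3)) (n 5 h1) using 1
      push_cast
      ring

/-- For `k ≥ 7` the valuation of `k` at `p` is at most `k - 6`. -/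
theorem natCast_inv_mem_padicFil {k : ℕ} (hp11 : 11 ≤ p) (hk : 7 ≤ k) :
    (k : ℚ)⁻¹ ∈ padicFil p (6 - k) := by
  obtain ⟨v, m, hm, hkm⟩ := Nat.exists_eq_pow_mul_and_not_dvd (n := k) (by lia) p hp.out.ne_one
  have hv : v + 6 ≤ k := by
    by_contra! hlt
    have h1 : p ^ v ≤ k := Nat.le_of_dvd (by lia) ⟨m, hkm⟩
    have h2 : 11 ^ v ≤ p ^ v := Nat.pow_le_pow_left hp11 v
    have h3 : ∀ w : ℕ, 2 ≤ w → w + 6 < 11 ^ w := fun w hw ↦ by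
      induction w, hw using Nat.le_induction with
      | base => norm_num
      | succ w _ ih =>
        rw [pow_succ]
        lia
    have h4 := h3 v (by lia)
    lia
  have h : (k : ℚ)⁻¹ = (p : ℚ) ^ (-(v : ℤ)) * (m : ℚ)⁻¹ := by
    rw [hkm, zpow_neg, zpow_natCast]
    push_cast
    rw [mul_inv]
  rw [h]
  exact padicFil_mono (l := 6 - k) (by lia) (mul_mem_padicFil (zpow_mem_padicFil _)
    (natCast_inv_mem_padicFil_zero hm) rfl)

/-- The division by `k` is harmless: for `7 ≤ k` the `k`-th Mahler coefficient is divisible by a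
high power of `p`, and a smaller `k` is prime to `p`. -/
theorem sixSumMahler_sub_div_mem (hp11 : 11 ≤ p) {k : ℕ} (hk : 0 < k) :
    (sixSumMahler p k - targetMahler p k) * (k : ℚ)⁻¹ ∈ padicFil p 1 := by
  by_cases hk7 : 7 ≤ k
  · rw [targetMahler, if_neg (by lia), sub_zero]
    exact mul_mem_padicFil (sixSumMahler_mem k) (natCast_inv_mem_padicFil hp11 hk7) (by ring)
  · exact mul_mem_padicFil (sixSumMahler_sub_mem hp11 k)
      (natCast_inv_mem_padicFil_zero (Nat.not_dvd_of_pos_of_lt hk (by lia))) (by ring)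

theorem six_mul_choose_two_add_choose_three (N : ℕ) :
    (6 : ℚ) * (N.choose 2 + N.choose 3) = (N : ℚ) ^ 3 - N := by
  induction N with
  | zero => simp
  | succ N ih =>
    rw [Nat.choose_succ_succ' N 1, Nat.choose_succ_succ' N 2, Nat.choose_one_right]
    push_cast
    linear_combination ih + 6 * Nat.cast_choose_two ℚ N

theorem sum_choose_mul_targetMahler (p N : ℕ) :
    ∑ k ∈ Finset.range (N + 1), N.choose k * targetMahler p k
      = 20 / 3 * ((N : ℚ) ^ 3 - N) * bernoulli (p - 3) ^ 2 := by
  have h : ∑ k ∈ Finset.range (N + 1), (N.choose k : ℚ) * targetMahler p k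
      = ∑ k ∈ Finset.range (N + 4), (N.choose k : ℚ) * targetMahler p k := by
    refine Finset.sum_subset (Finset.range_subset_range.2 (by lia)) fun k _ hk ↦ ?_
    rw [Nat.choose_eq_zero_of_lt (by simpa using hk), Nat.cast_zero, zero_mul]
  rw [h, ← Finset.sum_subset (s₁ := {2, 3})]
  · rw [Finset.sum_pair (by norm_num)]
    rw [targetMahler, if_pos (Or.inl rfl), targetMahler, if_pos (Or.inr rfl)]
    linear_combination 20 / 3 * bernoulli (p - 3) ^ 2 * six_mul_choose_two_add_choose_three N
  · intro k hk
    simp at hk ⊢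
    lia
  · intro k _ hk
    simp at hk
    rw [targetMahler, if_neg (by lia), mul_zero]

/-- A congruence modulo `p N`, uniform in `N`. The factor `N` comes from
`C(N, k) = (N / k) C(N - 1, k - 1)`. -/
theorem exists_sixSum_prime_mul_sub (hp11 : 11 ≤ p) {N : ℕ} (hN : 0 < N) :
    ∃ c ∈ localInt p, sixSum p (p * N)
      - 20 / 3 * ((N : ℚ) ^ 3 - N) * bernoulli (p - 3) ^ 2 = p * N * c := by
  obtain ⟨M, rfl⟩ := Nat.exists_eq_succ_of_ne_zero hN.ne'
  have hterm : ∑ k ∈ Finset.range (M + 1),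
      (M.choose k : ℚ) * ((sixSumMahler p (k + 1) - targetMahler p (k + 1)) * ((k + 1 : ℕ) : ℚ)⁻¹)
        ∈ padicFil p 1 :=
    sum_mem fun k _ ↦ natCast_mul_mem_padicFil _ (sixSumMahler_sub_div_mem hp11 k.succ_pos)
  obtain ⟨c, hc, h⟩ := hterm
  refine ⟨c, hc, ?_⟩
  rw [zpow_one] at h
  rw [sixSum_prime_mul, ← sum_choose_mul_targetMahler, ← Finset.sum_sub_distrib,
    mul_assoc, mul_left_comm, ← h, Finset.sum_range_succ', Finset.mul_sum]
  have h0 : sixSumMahler p 0 = 0 := coeff_zero_primeToLog_pow_six p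
  rw [h0, targetMahler, if_neg (by lia), mul_zero, sub_self, add_zero]
  refine Finset.sum_congr rfl fun k _ ↦ ?_
  have hch : ((M + 1).choose (k + 1) : ℚ) * ((k + 1 : ℕ) : ℚ) = ((M + 1 : ℕ) : ℚ) * M.choose k := by
    exact_mod_cast (Nat.add_one_mul_choose_eq M k).symm
  have hk : ((k + 1 : ℕ) : ℚ) ≠ 0 := by positivity
  rw [← mul_sub, ← mul_assoc, ← hch]
  field_simp

end Conclusion

/-! ### The congruences -/

theorem theorem4 (p n r : ℕ) (hp : p.Prime) (hp11 : 11 ≤ p) (hn : 0 < n) (hr : 0 < r)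
    (hdvd : p ^ r ∣ n) (hndvd : ¬ p ^ (r + 1) ∣ n) :
    (r = 1 → RatModEq p (sixSum p n)
      ((Nat.factorial 5 : ℚ) / 18 * (((n : ℚ) / p) ^ 3 - (n : ℚ) / p)
        * bernoulli (p - 3) ^ 2)) ∧
    (2 ≤ r → RatModEq (p ^ r) (sixSum p n)
      (-((Nat.factorial 5 : ℚ) / 18) * ((n : ℚ) / p) * bernoulli (p - 3) ^ 2)) := by
  have : Fact p.Prime := ⟨hp⟩
  have hp0 : (p : ℚ) ≠ 0 := prime_cast_ne_zero
  obtain ⟨s, rfl⟩ : ∃ s, r = s + 1 := ⟨r - 1, by lia⟩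
  obtain ⟨m, rfl⟩ := hdvd
  have hN : 0 < p ^ s * m := Nat.pos_of_ne_zero fun h ↦ by
    rw [pow_succ', mul_assoc, h] at hn
    exact hn.ne' rfl
  have he : p ^ (s + 1) * m = p * (p ^ s * m) := by rw [pow_succ', mul_assoc]
  have hdiv : ((p * (p ^ s * m) : ℕ) : ℚ) / p = (p ^ s * m : ℕ) := by
    rw [Nat.cast_mul, mul_div_cancel_left₀ _ hp0]
  have h5 : (Nat.factorial 5 : ℚ) / 18 = 20 / 3 := by norm_num [Nat.factorial]
  obtain ⟨c, hc, h⟩ := exists_sixSum_prime_mul_sub hp11 hN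
  rw [he, hdiv, h5]
  constructor
  · intro _
    exact ⟨(p ^ s * m : ℕ) * c, mul_mem (natCast_mem _ _) hc, by rw [h, mul_assoc]⟩
  · intro hs
    have hB : bernoulli (p - 3) ∈ localInt p := bernoulli_mem_localInt (by lia)
    have h3 : ((3 : ℕ) : ℚ)⁻¹ ∈ localInt p :=
      natCast_inv_mem_localInt (Nat.not_dvd_of_pos_of_lt (by norm_num) (by lia))
    obtain ⟨t, rfl⟩ : ∃ t, s = t + 1 := ⟨s - 1, by lia⟩
    -- the term `N ^ 3`, for `N = p ^ s m`, is divisible by `p ^ (3 s)`, and `3 s ≥ s + 1`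
    refine ⟨(m : ℕ) * c + (20 * p ^ (2 * t + 1) * m ^ 3 : ℕ) * ((3 : ℕ) : ℚ)⁻¹
      * bernoulli (p - 3) ^ 2, ?_, ?_⟩
    · exact Nat.Coprime.pow_right _ (mem_localInt.1 (add_mem (mul_mem (natCast_mem _ _) hc)
        (mul_mem (mul_mem (natCast_mem _ _) h3) (pow_mem hB 2))))
    · push_cast at h ⊢
      linear_combination h
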